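/- **Setting.** Let $(\Omega,\mathcal F,\mathbb P)$ be a probability space, $M>0$, $\rho>-1$, $W_0\in\mathbb R$, and let $X$ be a random loss with $X\in[0,M]$ almost surely, distribution function $F_X$ and quantile function $F_X^{-1}(t)=\inf\{x\ge 0: F_X(x)\ge t\}$, $t\in[0,1]$. Assume: * (Loss) $F_X$ is strictly increasing on $[0,M]$ and $F_X^{-1}$ is absolutely continuous on $[0,1]$ (so $X$ may have atoms). * (Weighting) $T:[0,1]\to[0,1]$ is continuous, strictly increasing and onto, twice differentiable on $(0,1)$; for some $b\in(0,1)$, $T'$ is strictly decreasing on $(0,b)$ and strictly increasing on $(b,1)$; $T'(0+)\in(1,+\infty]$ and $T'(1-)=+\infty$. * (Utility) $u:[0,\infty)\to[0,\infty)$ is continuous and strictly increasing, twice differentiable on $(0,\infty)$ with $u'$ strictly decreasing there, and has constant absolute risk aversion: $A_u:=-u''/u'$ is constant on $(0,\infty)$. * (Solvency) $W_0-(1+\rho)E[X]-M\ge 0$; put $W:=W_0-(1+\rho)E[X]$. Let $f(z):=\frac{1-T(z)}{1-z}$ on $[0,1)$. There is a unique $a\in(0,1)$ such that $f$ is strictly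 decreasing on $[0,a]$ and strictly increasing on $[a,1)$, and a unique $c\in(a,1)$ with $f(c)=1$, i.e. $T(c)=c$. Assume finally, with $A_T:=-T''/T'$, $$A_T(z)>A_u\big(W-F_X^{-1}(z)\big)\,(F_X^{-1})'(z)\quad\text{for all } z\in(0,a] \text{ at which } F_X^{-1} \text{ is differentiable}.$$ For a premium $\pi$ consider the problem $$\max_I\ V^{rdu}\big(W_0-\pi-X+I(X)\big)\quad\text{s.t. } (1+\rho)E[I(X)]\le\pi,\qquad I(0)=0,\ 0\le I(x)-I(y)\le x-y\ \ (0\le y\le x\le M),$$ where $V^{rdu}(Y)=\int_{[0,\infty)}u(x)\,d[-T(1-F_Y(x))]$. **Theorem.** There is a unique $l\in[a,c]$, the same for every $\pi\in[0,(1+\rho)E[X])$, with $$\int_0^{l}\Big[\tfrac{u'(W_0-\pi-F_X^{-1}(l))(1-T(l))}{1-l}-u'(W_0-\pi-F_X^{-1}(t))T'(t)\Big]dt=0 .$$ Let $K:=\int_0^{l}F_X^{-1}(z)\,dz+(1-l)F_X^{-1}(l)$ and $\widehat\pi:=(1+\rho)(E[X]-K)$. In each case below the problem has a solution $I^*$,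 unique as a function on $[0,M]$, given as follows. 1. If $\pi=(1+\rho)E[X]$, then $I^*(z)=z$ for $z\in[0,M]$. 2. If $\widehat\pi<\pi<(1+\rho)E[X]$, then $$I^*(z)=\begin{cases}z,&0\le z<F_X^{-1}(z_2),\\ F_X^{-1}(z_2),&F_X^{-1}(z_2)\le z<F_X^{-1}(z_1),\\ z-F_X^{-1}(z_1)+F_X^{-1}(z_2),&F_X^{-1}(z_1)\le z\le M,\end{cases}$$ where $0\le z_2\le a\le z_1<1$, $$\int_{z_2}^{z_1}\Big[\tfrac{u'(W_0-\pi-F_X^{-1}(z_1)+F_X^{-1}(z_2))(1-T(z_1))}{1-z_1}-u'(W_0-\pi-F_X^{-1}(t)+F_X^{-1}(z_2))T'(t)\Big]dt=0$$ and $E[I^*(X)]=\frac{\pi}{1+\rho}$. Such a pair $(z_2,z_1)$ exists; the thresholds $F_X^{-1}(z_2),F_X^{-1}(z_1)$ are the same for all such pairs, and the pair itself is unique whenever at least one of the two thresholds is not an atom of $X$ (in particular if $X$ has no atoms in $(0,M)$). 3. If $0\le\pi\le\widehat\pi$, then $$I^*(z)=\begin{cases}0,&0\le z<F_X^{-1}(s),\\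 z-F_X^{-1}(s),&F_X^{-1}(s)\le z\le M,\end{cases}$$ where $s\in[0,1]$ satisfies $E[I^*(X)]=\frac{\pi}{1+\rho}$. Such an $s$ exists; $F_X^{-1}(s)$ is the same for all such $s$, and $s$ itself is unique whenever $F_X^{-1}(s)$ is not an atom of $X$. -/

import Mathlib

open MeasureTheory ProbabilityTheory Set Filter Topology

namespace RDUInsurance

noncomputable section

/-- The quantile function `F_Y⁻¹(t) = inf {x ≥ 0 : P(Y ≤ x) ≥ t}` of a nonnegative random variable. -/
def quantile {Ω : Type*} [MeasurableSpace Ω] (P : Measure Ω) (Y : Ω → ℝ) (t : ℝ) : ℝ :=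
  sInf {x : ℝ | 0 ≤ x ∧ t ≤ cdf (P.map Y) x}

/-- The Arrow-Pratt measure of absolute risk aversion `A_g = -g''/g'`. -/
def arrowPratt (g : ℝ → ℝ) (x : ℝ) : ℝ := -deriv (deriv g) x / deriv g x

/-- The loss `X` takes values in `[0,M]`, its distribution function is strictly increasing
on `[0,M]`, and its quantile function is absolutely continuous on `[0,1]`. -/
structure LossAssumption {Ω : Type*} [MeasurableSpace Ω] (P : Measure Ω) (X : Ω → ℝ) (M : ℝ) :
    Prop where
  measurable : Measurable X
  support : ∀ᵐ ω ∂P, X ω ∈ Icc 0 M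
  strictMonoOn_cdf : StrictMonoOn (cdf (P.map X)) (Icc 0 M)
  absCont_quantile : AbsolutelyContinuousOnInterval (quantile P X) 0 1

/-- Inverse-S shaped probability weighting functions. The limit `T'(0+)` may be `+∞`. -/
structure InverseSShaped (T : ℝ → ℝ) : Prop where
  continuousOn : ContinuousOn T (Icc 0 1)
  strictMonoOn : StrictMonoOn T (Icc 0 1)
  map_zero : T 0 = 0
  map_one : T 1 = 1
  differentiableOn : DifferentiableOn ℝ T (Ioo 0 1)
  differentiableOn_deriv : DifferentiableOn ℝ (deriv T) (Ioo 0 1)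
  shape : ∃ b ∈ Ioo (0 : ℝ) 1,
    StrictAntiOn (deriv T) (Ioo 0 b) ∧ StrictMonoOn (deriv T) (Ioo b 1)
  deriv_zero : ∃ L : EReal, 1 < L ∧ Tendsto (fun z : ℝ => ((deriv T z : ℝ) : EReal)) (𝓝[>] 0) (𝓝 L)
  deriv_one : Tendsto (deriv T) (𝓝[<] 1) atTop

/-- Strictly increasing, strictly concave utility functions `[0,∞) → [0,∞)`. -/
structure StrictlyConcaveUtility (u : ℝ → ℝ) : Prop where
  nonneg : ∀ x, 0 ≤ x → 0 ≤ u x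
  continuousOn : ContinuousOn u (Ici 0)
  strictMonoOn : StrictMonoOn u (Ici 0)
  differentiableOn : DifferentiableOn ℝ u (Ioi 0)
  differentiableOn_deriv : DifferentiableOn ℝ (deriv u) (Ioi 0)
  strictAntiOn_deriv : StrictAntiOn (deriv u) (Ioi 0)

/-- Constant absolute risk aversion. -/
def IsCARA (u : ℝ → ℝ) : Prop := ∃ α : ℝ, ∀ x, 0 < x → arrowPratt u x = α

/-- The function `x ↦ -T(1 - F_Y(x))`, which is increasing and right-continuous. -/
def distortedCDF {Ω : Type*} [MeasurableSpace Ω] {T : ℝ → ℝ} (hT : InverseSShaped T)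
    (P : Measure Ω) (Y : Ω → ℝ) : StieltjesFunction ℝ where
  toFun x := -T (1 - cdf (P.map Y) x)
  mono' := by
    intro x y hxy
    have h := monotone_cdf (P.map Y) hxy
    have hx0 := cdf_nonneg (P.map Y) x
    have hx1 := cdf_le_one (P.map Y) x
    have hy0 := cdf_nonneg (P.map Y) y
    have hy1 := cdf_le_one (P.map Y) y
    exact neg_le_neg (hT.strictMonoOn.monotoneOn ⟨by linarith, by linarith⟩
      ⟨by linarith, by linarith⟩ (by linarith))
  right_continuous' := by
    intro x
    have hmaps : MapsTo (fun y => 1 - cdf (P.map Y) y) (Ici x) (Icc 0 1) := by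
      intro y _
      have hy0 := cdf_nonneg (P.map Y) y
      have hy1 := cdf_le_one (P.map Y) y
      exact ⟨by linarith, by linarith⟩
    have hc : ContinuousWithinAt (fun y => 1 - cdf (P.map Y) y) (Ici x) x :=
      ContinuousWithinAt.sub (f := fun _ => (1 : ℝ)) (g := fun y => cdf (P.map Y) y)
        continuousWithinAt_const ((cdf (P.map Y)).right_continuous x)
    exact (ContinuousWithinAt.comp (g := T) (f := fun y => 1 - cdf (P.map Y) y) (x := x)
      (t := Icc 0 1) (hT.continuousOn _ (hmaps self_mem_Ici)) hc hmaps).neg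

/-- Rank-dependent utility of the final wealth `Y`: the Lebesgue-Stieltjes integral
`∫_{[0,∞)} u(x) d[-T(1 - F_Y(x))]`. -/
def rdu {Ω : Type*} [MeasurableSpace Ω] {T : ℝ → ℝ} (hT : InverseSShaped T) (u : ℝ → ℝ)
    (P : Measure Ω) (Y : Ω → ℝ) : ℝ :=
  ∫ x in Ici 0, u x ∂(distortedCDF hT P Y).measure

/-- Indemnity functions on `[0,M]`: both the indemnity and the retention are increasing. -/
def IsIndemnity (M : ℝ) (I : ℝ → ℝ) : Prop :=
  I 0 = 0 ∧ ∀ x y, 0 ≤ y → y ≤ x → x ≤ M → 0 ≤ I x - I y ∧ I x - I y ≤ x - y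

/-- Contracts satisfying the insurer's participation constraint for the premium `π`. -/
def IsFeasible {Ω : Type*} [MeasurableSpace Ω] (P : Measure Ω) (X : Ω → ℝ) (M ρ π : ℝ)
    (I : ℝ → ℝ) : Prop :=
  IsIndemnity M I ∧ (1 + ρ) * ∫ ω, I (X ω) ∂P ≤ π

/-- `I` is an optimal solution of the insurance contracting problem. -/
def IsOptimal {Ω : Type*} [MeasurableSpace Ω] {T : ℝ → ℝ} (hT : InverseSShaped T) (u : ℝ → ℝ)
    (P : Measure Ω) (X : Ω → ℝ) (M ρ W₀ π : ℝ) (I : ℝ → ℝ) : Prop :=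
  IsFeasible P X M ρ π I ∧ ∀ J, IsFeasible P X M ρ π J →
    rdu hT u P (fun ω => W₀ - π - X ω + J (X ω)) ≤ rdu hT u P (fun ω => W₀ - π - X ω + I (X ω))

/-- The function `f(z) = (1 - T(z)) / (1 - z)` on `[0,1)`. -/
def chordSlope (T : ℝ → ℝ) (z : ℝ) : ℝ := (1 - T z) / (1 - z)

/-- `a` is the point at which `f` turns from strictly decreasing to strictly increasing. -/
def IsTurningPoint (T : ℝ → ℝ) (a : ℝ) : Prop :=
  a ∈ Ioo 0 1 ∧ StrictAntiOn (chordSlope T) (Icc 0 a) ∧ StrictMonoOn (chordSlope T) (Ico a 1)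

/-- `c` is the point to the right of `a` with `f(c) = 1`, that is, `T(c) = c`. -/
def IsCrossingPoint (T : ℝ → ℝ) (a c : ℝ) : Prop := c ∈ Ioo a 1 ∧ chordSlope T c = 1

/-- Decreasing absolute risk aversion of `u`, and dominance of the weighting over the risk
aversion on `(0,a]`, where `W = W₀ - (1+ρ)E[X]`. The dominance is only required where the
quantile function, which is merely absolutely continuous, has a derivative. -/
structure RiskAversionAssumption {Ω : Type*} [MeasurableSpace Ω] (P : Measure Ω) (X : Ω → ℝ)
    (T u : ℝ → ℝ) (W a : ℝ) : Prop where
  antitoneOn : AntitoneOn (arrowPratt u) (Ioi 0)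
  dominance : ∀ z ∈ Ioc 0 a, DifferentiableAt ℝ (quantile P X) z →
    arrowPratt u (W - quantile P X z) * deriv (quantile P X) z < arrowPratt T z

/-- The function `h` at the wealth `w = W_Δ = W₀ - π` after payment of the premium. -/
def hFun {Ω : Type*} [MeasurableSpace Ω] (P : Measure Ω) (X : Ω → ℝ) (T u : ℝ → ℝ)
    (w z : ℝ) : ℝ :=
  ∫ t in (0 : ℝ)..z, (deriv u (w - quantile P X z) * (1 - T z) / (1 - z)
    - deriv u (w - quantile P X t) * deriv T t)

/-- `K = ∫₀¹ G(z) dz`, where `G = F_X⁻¹` on `[0,l)` and `G = F_X⁻¹(l)` on `[l,1]`. -/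
def retainedMean {Ω : Type*} [MeasurableSpace Ω] (P : Measure Ω) (X : Ω → ℝ) (l : ℝ) : ℝ :=
  ∫ z in (0 : ℝ)..1, if z < l then quantile P X z else quantile P X l

/-- The threefold contract with thresholds `d₂ ≤ d₁`. -/
def threefold (d₂ d₁ z : ℝ) : ℝ := if z < d₂ then z else if z < d₁ then d₂ else z - d₁ + d₂

/-- The deductible contract with deductible `d`. -/
def deductible (d z : ℝ) : ℝ := if z < d then 0 else z - d

/-- The conditions that determine `(z₂, z₁)`: `z₂ ≤ a ≤ z₁`, the integral equation at the wealth
`W₀ - π`, and the budget equation. -/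
def IsThreefoldPair {Ω : Type*} [MeasurableSpace Ω] (P : Measure Ω) (X : Ω → ℝ) (T u : ℝ → ℝ)
    (ρ W₀ a π z₂ z₁ : ℝ) : Prop :=
  0 ≤ z₂ ∧ z₂ ≤ a ∧ a ≤ z₁ ∧ z₁ < 1 ∧
  (∫ t in z₂..z₁,
    (deriv u (W₀ - π - quantile P X z₁ + quantile P X z₂) * (1 - T z₁) / (1 - z₁)
      - deriv u (W₀ - π - quantile P X t + quantile P X z₂) * deriv T t)) = 0 ∧
  ∫ ω, threefold (quantile P X z₂) (quantile P X z₁) (X ω) ∂P = π / (1 + ρ)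

/-- The condition that determines `s`: the budget equation of the deductible contract with
deductible `F_X⁻¹(s)`. -/
def IsDeductibleLevel {Ω : Type*} [MeasurableSpace Ω] (P : Measure Ω) (X : Ω → ℝ)
    (ρ π s : ℝ) : Prop :=
  s ∈ Icc 0 1 ∧ ∫ ω, deductible (quantile P X s) (X ω) ∂P = π / (1 + ρ)

end

end RDUInsurance

open RDUInsurance

namespace RDUInsurance

/-! ### Inverse-S shaped weighting functions -/

namespace InverseSShaped

variable {T : ℝ → ℝ}

/-! Constant absolute risk aversion forces `u x = B - A * exp (-α x)`. Write `Q` for the quantile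
function and `G = Q - I ∘ Q` for the retained loss in quantile form. Rank-dependent utility becomes
`B - A * exp (-α w) * ∫ exp (α G) T'` (`rdu_indemnity`), so the wealth `w = W₀ - π` only enters
through a positive factor. This is why `l` does not depend on the premium. What remains is to
minimise the convex functional `∫ exp (α G) T'` over `G` with `G 0 = 0` and increments between `0`
and those of `Q`, under a lower bound on `∫ G`.

By convexity a first-order condition with multiplier `r ≥ 0` is sufficient, and since `T' > 0`
almost everywhere the minimiser is unique (`eqOn_of_integral_exp_le`). The candidate retains the
layer of the loss between `Q z₂` and `Q z₁`, with `r = exp (α (Q z₁ - Q z₂)) * f z₁`, where `f` is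
`chordSlope T`. Integration by parts turns the condition into sign requirements on the tail integral
`N z` of `margin` over `[z,1]`: nonnegative on `(0,z₂)` and `[z₁,1]`, nonpositive on `[z₂,z₁]`. The
choice of `r` gives `N z₁ = 0`. On `[a,1]` the signs follow from monotonicity of `f`. On `(0,a]` the
dominance of `A_T` makes `exp (α Q) T'` decreasing (`strictAntiOn_exp_mul_deriv`), so `N` is convex
there. Moreover `N z₂` is minus the `gap`, and the integral equation of the theorem says that the
gap vanishes; at the corner `z₂ = 0` a nonnegative gap is enough.

The gap is strictly increasing in `z₁` on `[a,1)` (`strictMonoOn_gap`), hence has a zero `ζ z₂` that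
depends continuously on `z₂`, with `ζ 0 = l` and `ζ a = a`. Along this curve the retained mean runs
from `K` to `0`, and the intermediate value theorem meets any budget above that of `π̂`. For smaller
budgets one keeps `z₂ = 0` and raises `z₁` above `l`. Thresholds are read off from the unique
optimal contract, and levels from thresholds that are not atoms. -/

lemma hasDerivAt (hT : InverseSShaped T) {t : ℝ} (ht : t ∈ Ioo (0 : ℝ) 1) :
    HasDerivAt T (deriv T t) t :=
  (hT.differentiableOn.differentiableAt (isOpen_Ioo.mem_nhds ht)).hasDerivAt

lemma continuousOn_deriv (hT : InverseSShaped T) : ContinuousOn (deriv T) (Ioo 0 1) :=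
  hT.differentiableOn_deriv.continuousOn

lemma deriv_nonneg (hT : InverseSShaped T) {t : ℝ} (ht : t ∈ Ioo (0 : ℝ) 1) :
    0 ≤ deriv T t := by
  rw [← derivWithin_of_mem_nhds (Icc_mem_nhds ht.1 ht.2)]
  exact hT.strictMonoOn.monotoneOn.derivWithin_nonneg

lemma exists_mean_deriv (hT : InverseSShaped T) {x y : ℝ} (hx : 0 ≤ x) (hxy : x < y)
    (hy : y ≤ 1) : ∃ ξ ∈ Ioo x y, T y - T x = deriv T ξ * (y - x) := by
  obtain ⟨ξ, hξ, h⟩ := exists_hasDerivAt_eq_slope T (deriv T) hxy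
    (hT.continuousOn.mono (Icc_subset_Icc hx hy))
    (fun t ht => hT.hasDerivAt ⟨hx.trans_lt ht.1, ht.2.trans_le hy⟩)
  refine ⟨ξ, hξ, ?_⟩
  rw [h, div_mul_cancel₀ _ (sub_pos.2 hxy).ne']

/-- `T'` is differentiable, hence continuous, at `b`, so both monotonicities extend to `b` in the
limit; a midpoint keeps them strict. -/
lemma exists_inflection (hT : InverseSShaped T) : ∃ b ∈ Ioo (0 : ℝ) 1,
    StrictAntiOn (deriv T) (Ioc 0 b) ∧ StrictMonoOn (deriv T) (Ico b 1) := by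
  obtain ⟨b, hb, h₁, h₂⟩ := hT.shape
  have hc : ContinuousAt (deriv T) b := hT.continuousOn_deriv.continuousAt (Ioo_mem_nhds hb.1 hb.2)
  have left : ∀ x ∈ Ioo 0 b, deriv T b ≤ deriv T x := by
    intro x hx
    refine le_of_tendsto (hc.tendsto.mono_left (nhdsWithin_le_nhds (s := Iio b))) ?_
    filter_upwards [Ioo_mem_nhdsLT hx.2] with y hy
    exact (h₁ hx ⟨hx.1.trans hy.1, hy.2⟩ hy.1).le
  have right : ∀ x ∈ Ioo b 1, deriv T b ≤ deriv T x := by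
    intro x hx
    refine le_of_tendsto (hc.tendsto.mono_left (nhdsWithin_le_nhds (s := Ioi b))) ?_
    filter_upwards [Ioo_mem_nhdsGT hx.1] with y hy
    exact (h₂ ⟨hy.1, hy.2.trans hx.2⟩ hx hy.2).le
  refine ⟨b, hb, ?_, ?_⟩
  · intro x hx y hy hxy
    have hm : x < (x + y) / 2 ∧ (x + y) / 2 < y := by constructor <;> linarith
    have hxb : x ∈ Ioo 0 b := ⟨hx.1, hxy.trans_le hy.2⟩
    have hmb : (x + y) / 2 ∈ Ioo 0 b := ⟨hx.1.trans hm.1, hm.2.trans_le hy.2⟩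
    rcases hy.2.lt_or_eq with h | h
    · exact h₁ hxb ⟨hy.1, h⟩ hxy
    · subst h
      exact (left _ hmb).trans_lt (h₁ hxb hmb hm.1)
  · intro x hx y hy hxy
    have hm : x < (x + y) / 2 ∧ (x + y) / 2 < y := by constructor <;> linarith
    have hyb : y ∈ Ioo b 1 := ⟨hx.1.trans_lt hxy, hy.2⟩
    have hmb : (x + y) / 2 ∈ Ioo b 1 := ⟨hx.1.trans_lt hm.1, hm.2.trans hy.2⟩
    rcases hx.1.lt_or_eq with h | h
    · exact h₂ ⟨h, hx.2⟩ hyb hxy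
    · subst h
      exact (right _ hmb).trans_lt (h₂ hmb hyb hm.2)

lemma deriv_pos_of_lt (hT : InverseSShaped T) {b t : ℝ} (hb : b < 1)
    (h : StrictAntiOn (deriv T) (Ioc 0 b)) (ht : t ∈ Ioo 0 b) : 0 < deriv T t := by
  have := h ⟨ht.1, ht.2.le⟩ ⟨ht.1.trans ht.2, le_rfl⟩ ht.2
  exact (hT.deriv_nonneg ⟨ht.1.trans ht.2, hb⟩).trans_lt this

/-- A nonnegative function that is strictly monotone on either side of `b` can vanish only at `b`.
This is what yields uniqueness of the optimal contract. -/
lemma ae_deriv_pos (hT : InverseSShaped T) : ∀ᵐ t : ℝ, t ∈ Ioc (0 : ℝ) 1 → 0 < deriv T t := by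
  obtain ⟨b, hb, h₁, h₂⟩ := hT.exists_inflection
  have h : ∀ᵐ t : ℝ, t ≠ b ∧ t ≠ 1 := by
    rw [eventually_and]
    constructor <;> simp [ae_iff, measure_singleton]
  filter_upwards [h] with t ⟨htb, ht1⟩ ht
  rcases htb.lt_or_gt with hlt | hgt
  · exact hT.deriv_pos_of_lt hb.2 h₁ ⟨ht.1, hlt⟩
  · exact (hT.deriv_nonneg hb).trans_lt
      (h₂ ⟨le_rfl, hb.2⟩ ⟨hgt.le, ht.2.lt_of_ne ht1⟩ hgt)

/-- `T'` may be unbounded at both endpoints; integrability comes from monotonicity of `T`. -/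
lemma intervalIntegrable_deriv (hT : InverseSShaped T) :
    IntervalIntegrable (deriv T) volume 0 1 := by
  apply MonotoneOn.intervalIntegrable_deriv
  rw [uIcc_of_le zero_le_one]
  exact hT.strictMonoOn.monotoneOn

lemma integral_deriv (hT : InverseSShaped T) {x y : ℝ} (hx : 0 ≤ x) (hxy : x ≤ y) (hy : y ≤ 1) :
    ∫ t in x..y, deriv T t = T y - T x := by
  apply intervalIntegral.integral_eq_sub_of_hasDerivAt_of_le hxy
    (hT.continuousOn.mono (Icc_subset_Icc hx hy))
    (fun t ht => hT.hasDerivAt ⟨hx.trans_lt ht.1, ht.2.trans_le hy⟩)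
  apply hT.intervalIntegrable_deriv.mono_set
  rw [uIcc_of_le hxy, uIcc_of_le zero_le_one]
  exact Icc_subset_Icc hx hy

lemma mem_Icc (hT : InverseSShaped T) {x : ℝ} (hx : x ∈ Icc (0 : ℝ) 1) : T x ∈ Icc (0 : ℝ) 1 := by
  constructor
  · rw [← hT.map_zero]
    exact hT.strictMonoOn.monotoneOn ⟨le_rfl, zero_le_one⟩ hx hx.1
  · rw [← hT.map_one]
    exact hT.strictMonoOn.monotoneOn hx ⟨zero_le_one, le_rfl⟩ hx.2

lemma continuousOn_chordSlope (hT : InverseSShaped T) :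
    ContinuousOn (chordSlope T) (Ico 0 1) := by
  apply ContinuousOn.div
  · exact continuousOn_const.sub (hT.continuousOn.mono Ico_subset_Icc_self)
  · exact continuousOn_const.sub continuousOn_id
  · intro x hx
    exact (sub_pos.2 hx.2).ne'

lemma chordSlope_mul (T : ℝ → ℝ) {z : ℝ} (hz : z < 1) : chordSlope T z * (1 - z) = 1 - T z :=
  div_mul_cancel₀ _ (sub_pos.2 hz).ne'

lemma chordSlope_pos (hT : InverseSShaped T) {z : ℝ} (hz : z ∈ Ico (0 : ℝ) 1) :
    0 < chordSlope T z := by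
  apply div_pos _ (sub_pos.2 hz.2)
  have := hT.strictMonoOn ⟨hz.1, hz.2.le⟩ ⟨zero_le_one, le_rfl⟩ hz.2
  rw [hT.map_one] at this
  linarith

/-- By the mean value theorem the chord slope at `z` is `T' ξ` for some `ξ` between `z` and `1`. -/
lemma tendsto_chordSlope (hT : InverseSShaped T) :
    Tendsto (chordSlope T) (𝓝[<] 1) atTop := by
  rw [tendsto_atTop]
  intro C
  obtain ⟨l, hl, h⟩ := mem_nhdsLT_iff_exists_Ioo_subset.1
    ((hT.deriv_one.eventually_ge_atTop C))
  filter_upwards [Ioo_mem_nhdsLT hl, Ioo_mem_nhdsLT (zero_lt_one (α := ℝ))] with z hz hz0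
  obtain ⟨ξ, hξ, e⟩ := hT.exists_mean_deriv hz0.1.le hz.2 le_rfl
  have h1 : C ≤ deriv T ξ := h ⟨hz.1.trans hξ.1, hξ.2⟩
  rw [hT.map_one] at e
  rw [chordSlope, e, mul_div_cancel_right₀ _ (sub_pos.2 hz.2).ne']
  exact h1

/-- The chord slope from `z` to `1` minus the slope at `z`, up to the factor `1 - z`, changes
sign exactly once on `(0,1)`, on the concave part of `T`. -/
lemma exists_sign_change (hT : InverseSShaped T) : ∃ a b : ℝ, 0 < a ∧ a < b ∧ b < 1 ∧
    StrictAntiOn (deriv T) (Ioc 0 b) ∧ 1 - T a - deriv T a * (1 - a) = 0 ∧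
    (∀ z ∈ Ioo 0 a, 1 - T z - deriv T z * (1 - z) < 0) ∧
    (∀ z ∈ Ioo a 1, 0 < 1 - T z - deriv T z * (1 - z)) := by
  obtain ⟨b, hb, h₁, h₂⟩ := hT.exists_inflection
  set g : ℝ → ℝ := fun z => 1 - T z - deriv T z * (1 - z) with hg
  have hright : ∀ z ∈ Ico b 1, 0 < g z := by
    intro z hz
    obtain ⟨ξ, hξ, e⟩ := hT.exists_mean_deriv (hb.1.le.trans hz.1) hz.2 le_rfl
    have h3 := h₂ hz ⟨hz.1.trans hξ.1.le, hξ.2⟩ hξ.1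
    rw [hT.map_one] at e
    simp only [hg, e, ← sub_mul]
    exact mul_pos (sub_pos.2 h3) (sub_pos.2 hz.2)
  -- Formally `g' = -T'' (1 - z)`; the mean value theorem for `T` avoids any sign information on
  -- `T''`.
  have hmono : StrictMonoOn g (Ioc 0 b) := by
    intro x hx y hy hxy
    obtain ⟨ξ, hξ, e⟩ := hT.exists_mean_deriv hx.1.le hxy (hy.2.trans hb.2.le)
    have h3 := h₁ hx ⟨hx.1.trans hξ.1, hξ.2.le.trans hy.2⟩ hξ.1
    have h4 := h₁ hx hy hxy
    have h5 : (deriv T x - deriv T y) * (1 - y) > 0 :=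
      mul_pos (sub_pos.2 h4) (by linarith [hy.2, hb.2])
    have h6 : (deriv T x - deriv T ξ) * (y - x) > 0 := mul_pos (sub_pos.2 h3) (by linarith)
    simp only [hg]
    nlinarith
  obtain ⟨L, hL, hlim⟩ := hT.deriv_zero
  obtain ⟨r, hr1, hrL⟩ := EReal.lt_iff_exists_real_btwn.1 hL
  have hr1' : 1 < r := by exact_mod_cast hr1
  have hev : ∀ᶠ z in 𝓝[>] (0 : ℝ), r < deriv T z := by
    filter_upwards [hlim.eventually (lt_mem_nhds hrL)] with z hz
    exact_mod_cast hz
  -- For `x < 1 - 1 / r` one has `r (1 - x) > 1`, so `T' x > r` forces `g x < 0`.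
  have hpos : 0 < 1 - 1 / r := by
    rw [sub_pos, div_lt_one (by linarith)]
    exact hr1'
  obtain ⟨x, hxr, hx1, hx2⟩ := (hev.and (inter_mem (Ioo_mem_nhdsGT hpos) (Ioo_mem_nhdsGT hb.1))).exists
  have hgx : g x < 0 := by
    have h3 := (hT.mem_Icc ⟨hx2.1.le, (hx2.2.trans hb.2).le⟩).1
    have h4 : 1 < r * (1 - x) := by
      have : 1 / r < 1 - x := by linarith [hx1.2]
      rwa [div_lt_iff₀' (by linarith)] at this
    have h5 : r * (1 - x) < deriv T x * (1 - x) :=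
      mul_lt_mul_of_pos_right hxr (by linarith [hx2.2, hb.2])
    simp only [hg]
    linarith
  have hcont : ContinuousOn g (Ioo 0 1) :=
    (continuousOn_const.sub (hT.continuousOn.mono Ioo_subset_Icc_self)).sub
      (hT.continuousOn_deriv.mul (continuousOn_const.sub continuousOn_id))
  obtain ⟨a, ha, hga⟩ : (0 : ℝ) ∈ g '' Ioo x b :=
    intermediate_value_Ioo hx2.2.le
      (hcont.mono fun t ht => ⟨hx2.1.trans_le ht.1, ht.2.trans_lt hb.2⟩)
      ⟨hgx, hright b ⟨le_rfl, hb.2⟩⟩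
  have ha0 : 0 < a := hx2.1.trans ha.1
  refine ⟨a, b, ha0, ha.2, hb.2, h₁, hga, ?_, ?_⟩
  · intro z hz
    rw [← hga]
    exact hmono ⟨hz.1, (hz.2.trans ha.2).le⟩ ⟨ha0, ha.2.le⟩ hz.2
  · intro z hz
    rcases le_total z b with h | h
    · rw [← hga]
      exact hmono ⟨ha0, ha.2.le⟩ ⟨ha0.trans hz.1, h⟩ hz.1
    · exact hright z ⟨h, hz.2⟩

lemma hasDerivAt_chordSlope (hT : InverseSShaped T) {z : ℝ} (hz : z ∈ Ioo (0 : ℝ) 1) :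
    HasDerivAt (chordSlope T) ((1 - T z - deriv T z * (1 - z)) / (1 - z) ^ 2) z := by
  have h := ((hT.hasDerivAt hz).const_sub 1).div ((hasDerivAt_id z).const_sub 1)
    (sub_pos.2 hz.2).ne'
  refine h.congr_deriv ?_
  simp only [id]
  ring

/-- Existence and uniqueness of the turning point, which lies on the concave part of `T`. -/
lemma exists_turningPoint (hT : InverseSShaped T) : ∃ a : ℝ, (∀ x, IsTurningPoint T x ↔ x = a) ∧
    deriv T a = chordSlope T a ∧ ∃ b, a < b ∧ b < 1 ∧ StrictAntiOn (deriv T) (Ioc 0 b) := by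
  obtain ⟨a, b, ha, hab, hb, hanti, hzero, hneg, hpos⟩ := hT.exists_sign_change
  have ha1 : a < 1 := hab.trans hb
  have hturn : IsTurningPoint T a := by
    refine ⟨⟨ha, ha1⟩, ?_, ?_⟩
    · apply strictAntiOn_of_deriv_neg (convex_Icc 0 a)
        (hT.continuousOn_chordSlope.mono fun t ht => ⟨ht.1, ht.2.trans_lt ha1⟩)
      intro z hz
      rw [interior_Icc] at hz
      rw [(hT.hasDerivAt_chordSlope ⟨hz.1, hz.2.trans ha1⟩).deriv]
      exact div_neg_of_neg_of_pos (hneg z hz) (by nlinarith [hz.2])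
    · apply strictMonoOn_of_deriv_pos (convex_Ico a 1)
        (hT.continuousOn_chordSlope.mono fun t ht => ⟨ha.le.trans ht.1, ht.2⟩)
      intro z hz
      rw [interior_Ico] at hz
      rw [(hT.hasDerivAt_chordSlope ⟨ha.trans hz.1, hz.2⟩).deriv]
      exact div_pos (hpos z hz) (by nlinarith [hz.2])
  have key : ∀ x y, IsTurningPoint T x → IsTurningPoint T y → ¬ x < y := by
    intro x y hx hy hxy
    have h1 := hy.2.1 ⟨hx.1.1.le, hxy.le⟩ ⟨hy.1.1.le, le_rfl⟩ hxy
    have h2 := hx.2.2 ⟨le_rfl, hx.1.2⟩ ⟨hxy.le, hy.1.2⟩ hxy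
    exact lt_asymm h1 h2
  refine ⟨a, fun x => ⟨fun hx => ?_, fun hx => hx ▸ hturn⟩, ?_, b, hab, hb, hanti⟩
  · exact le_antisymm (not_lt.1 (key _ _ hturn hx)) (not_lt.1 (key _ _ hx hturn))
  · rw [chordSlope, eq_div_iff (sub_pos.2 ha1).ne']
    linarith

/-- The chord slope is `1` at `0`, falls below `1` at `a`, then increases strictly to `+∞`. -/
lemma exists_crossingPoint (hT : InverseSShaped T) {a : ℝ} (ha : IsTurningPoint T a) :
    ∃ c, ∀ x, IsCrossingPoint T a x ↔ x = c := by
  have h0 : chordSlope T 0 = 1 := by simp [chordSlope, hT.map_zero]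
  have hlt : chordSlope T a < 1 := by
    rw [← h0]
    exact ha.2.1 ⟨le_rfl, ha.1.1.le⟩ ⟨ha.1.1.le, le_rfl⟩ ha.1.1
  obtain ⟨z, hz1, hz2⟩ := ((hT.tendsto_chordSlope.eventually_gt_atTop 1).and
    (Ioo_mem_nhdsLT ha.1.2)).exists
  obtain ⟨c, hc, hfc⟩ : (1 : ℝ) ∈ chordSlope T '' Ioo a z :=
    intermediate_value_Ioo hz2.1.le
      (hT.continuousOn_chordSlope.mono fun t ht => ⟨ha.1.1.le.trans ht.1, ht.2.trans_lt hz2.2⟩)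
      ⟨hlt, hz1⟩
  have hc1 : c < 1 := hc.2.trans hz2.2
  refine ⟨c, fun x => ⟨fun hx => ?_, ?_⟩⟩
  · exact ha.2.2.injOn ⟨hx.1.1.le, hx.1.2⟩ ⟨hc.1.le, hc1⟩ (hx.2.trans hfc.symm)
  · rintro rfl
    exact ⟨⟨hc.1, hc1⟩, hfc⟩

end InverseSShaped

/-! ### Utilities with constant absolute risk aversion -/

lemma StrictlyConcaveUtility.deriv_pos {u : ℝ → ℝ} (hu : StrictlyConcaveUtility u) {x : ℝ}
    (hx : 0 < x) : 0 < deriv u x := by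
  have hnonneg : ∀ y, 0 < y → 0 ≤ deriv u y := by
    intro y hy
    rw [← derivWithin_of_mem_nhds (Ici_mem_nhds hy)]
    exact hu.strictMonoOn.monotoneOn.derivWithin_nonneg
  have h1 : (0 : ℝ) < x + 1 := by linarith
  exact (hnonneg _ h1).trans_lt (hu.strictAntiOn_deriv hx h1 (by linarith))

/-- A utility with constant absolute risk aversion is exponential. -/
lemma StrictlyConcaveUtility.exists_eq_exp {u : ℝ → ℝ} (hu : StrictlyConcaveUtility u)
    (hcara : IsCARA u) : ∃ α A B : ℝ, 0 < α ∧ 0 < A ∧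
      (∀ x, 0 ≤ x → u x = B - A * Real.exp (-α * x)) ∧
      (∀ x, 0 < x → deriv u x = A * α * Real.exp (-α * x)) ∧
      ∀ x, 0 < x → arrowPratt u x = α := by
  obtain ⟨α, hα⟩ := hcara
  have hd : ∀ x, 0 < x → HasDerivAt u (deriv u x) x := fun x hx =>
    (hu.differentiableOn.differentiableAt (Ioi_mem_nhds hx)).hasDerivAt
  have hdd : ∀ x, 0 < x → HasDerivAt (deriv u) (-α * deriv u x) x := by
    intro x hx
    have h := (hu.differentiableOn_deriv.differentiableAt (Ioi_mem_nhds hx)).hasDerivAt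
    have h1 := hα x hx
    rw [arrowPratt, div_eq_iff (hu.deriv_pos hx).ne'] at h1
    exact h.congr_deriv (by linarith)
  have hexp : ∀ β x : ℝ, HasDerivAt (fun y => Real.exp (β * y)) (β * Real.exp (β * x)) x := by
    intro β x
    have := ((hasDerivAt_id x).const_mul β).exp
    simpa [mul_comm] using this
  have hconst : ∀ x ∈ Ioi (0 : ℝ), deriv u x * Real.exp (α * x) =
      deriv u 1 * Real.exp (α * 1) := by
    have hder : ∀ x, 0 < x →
        HasDerivAt (fun y => deriv u y * Real.exp (α * y)) 0 x := by
      intro x hx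
      convert! (hdd x hx).mul (hexp α x) using 1
      ring
    intro x hx
    exact isOpen_Ioi.is_const_of_deriv_eq_zero isPreconnected_Ioi
      (fun y hy => (hder y hy).differentiableAt.differentiableWithinAt)
      (fun y hy => (hder y hy).deriv) hx (mem_Ioi.2 one_pos)
  set k := deriv u 1 * Real.exp (α * 1) with hk
  have hkpos : 0 < k := mul_pos (hu.deriv_pos one_pos) (Real.exp_pos _)
  have hform : ∀ x, 0 < x → deriv u x = k * Real.exp (-α * x) := by
    intro x hx
    rw [← hconst x hx, mul_assoc, ← Real.exp_add]
    simp
  -- The constant in `IsCARA` has no prescribed sign; strict decrease of `u'` makes it positive.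
  have hαpos : 0 < α := by
    have h := hu.strictAntiOn_deriv (mem_Ioi.2 one_pos) (mem_Ioi.2 two_pos) one_lt_two
    rw [hform 1 one_pos, hform 2 two_pos] at h
    have h2 := Real.exp_lt_exp.1 (lt_of_mul_lt_mul_left h hkpos.le)
    linarith
  have hu0 : ∀ x ∈ Ioi (0 : ℝ), u x + k / α * Real.exp (-α * x) =
      u 1 + k / α * Real.exp (-α * 1) := by
    have hder : ∀ x, 0 < x →
        HasDerivAt (fun y => u y + k / α * Real.exp (-α * y)) 0 x := by
      intro x hx
      convert! (hd x hx).add ((hexp (-α) x).const_mul (k / α)) using 1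
      rw [hform x hx]
      field_simp
      ring
    intro x hx
    exact isOpen_Ioi.is_const_of_deriv_eq_zero isPreconnected_Ioi
      (fun y hy => (hder y hy).differentiableAt.differentiableWithinAt)
      (fun y hy => (hder y hy).deriv) hx (mem_Ioi.2 one_pos)
  refine ⟨α, k / α, u 1 + k / α * Real.exp (-α * 1), hαpos, div_pos hkpos hαpos, ?_, ?_, hα⟩
  -- The differential equation lives on the open half-line; continuity of `u` adds the point `0`.
  · have hclos : EqOn (fun x => u x + k / α * Real.exp (-α * x))
        (fun _ => u 1 + k / α * Real.exp (-α * 1)) (Ici 0) := by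
      apply EqOn.of_subset_closure (s := Ioi 0) hu0
      · exact hu.continuousOn.add (by fun_prop)
      · exact continuousOn_const
      · exact Ioi_subset_Ici_self
      · rw [closure_Ioi]
    intro x hx
    have := hclos hx
    simp only at this
    linarith
  · intro x hx
    rw [hform x hx]
    field_simp

/-! ### Quantile functions and rank-dependent utility in quantile form -/

section Quantile

variable {Ω : Type*} [MeasurableSpace Ω] {P : Measure Ω} {X : Ω → ℝ} {M : ℝ}

lemma quantile_nonneg (P : Measure Ω) (X : Ω → ℝ) (t : ℝ) : 0 ≤ quantile P X t :=
  Real.sInf_nonneg fun _ hx => hx.1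

lemma bddBelow_quantile_set (P : Measure Ω) (X : Ω → ℝ) (t : ℝ) :
    BddBelow {x : ℝ | 0 ≤ x ∧ t ≤ cdf (P.map X) x} := ⟨0, fun _ hx => hx.1⟩

lemma LossAssumption.continuousOn_quantile (hX : LossAssumption P X M) :
    ContinuousOn (quantile P X) (Icc 0 1) := by
  have := hX.absCont_quantile.continuousOn
  rwa [uIcc_of_le zero_le_one] at this

lemma LossAssumption.aemeasurable_quantile (hX : LossAssumption P X M) :
    AEMeasurable (quantile P X) (volume.restrict (Ioc 0 1)) :=
  (hX.continuousOn_quantile.mono Ioc_subset_Icc_self).aemeasurable measurableSet_Ioc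

/-- Contracts are only controlled on `[0,M]`. Clamping gives a globally continuous, hence
measurable, substitute that agrees almost surely along the loss. -/
lemma continuous_comp_clamp {φ : ℝ → ℝ} (hM : 0 < M) (hφ : ContinuousOn φ (Icc 0 M)) :
    Continuous fun x => φ (max 0 (min x M)) := by
  apply hφ.comp_continuous (by fun_prop)
  intro x
  exact ⟨le_max_left _ _, max_le hM.le (min_le_right _ _)⟩

lemma clamp_eq {x : ℝ} (hx : x ∈ Icc 0 M) : max 0 (min x M) = x := by
  rw [min_eq_left hx.2, max_eq_right hx.1]

lemma LossAssumption.ae_comp_clamp (hX : LossAssumption P X M) (φ : ℝ → ℝ) :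
    (fun ω => φ (X ω)) =ᵐ[P] fun ω => φ (max 0 (min (X ω) M)) := by
  filter_upwards [hX.support] with ω hω
  rw [clamp_eq hω]

variable [IsProbabilityMeasure P]

lemma LossAssumption.isProbabilityMeasure_map (hX : LossAssumption P X M) :
    IsProbabilityMeasure (P.map X) :=
  Measure.isProbabilityMeasure_map hX.measurable.aemeasurable

lemma LossAssumption.cdf_top (hX : LossAssumption P X M) : cdf (P.map X) M = 1 := by
  have := hX.isProbabilityMeasure_map
  rw [cdf_eq_real, Measure.real, ENNReal.toReal_eq_one_iff, Measure.map_apply hX.measurable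
    measurableSet_Iic, prob_compl_eq_zero_iff (hX.measurable measurableSet_Iic) |>.symm]
  rw [← mem_ae_iff]
  filter_upwards [hX.support] with ω hω using hω.2

lemma LossAssumption.cdf_of_neg (hX : LossAssumption P X M) {x : ℝ} (hx : x < 0) :
    cdf (P.map X) x = 0 := by
  have := hX.isProbabilityMeasure_map
  rw [cdf_eq_real, Measure.real, Measure.map_apply hX.measurable measurableSet_Iic,
    measure_mono_null (t := {ω | ¬ X ω ∈ Icc 0 M}) _ hX.support]
  · rfl
  · intro ω hω h
    exact absurd (h.1.trans hω) (not_le.2 hx)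

/-- Right-continuity of the distribution function makes the infimum attained. -/
lemma LossAssumption.le_cdf_quantile (hX : LossAssumption P X M) (hM : 0 < M) {t : ℝ}
    (ht : t ≤ 1) : t ≤ cdf (P.map X) (quantile P X t) := by
  by_contra! h
  have hne : {x : ℝ | 0 ≤ x ∧ t ≤ cdf (P.map X) x}.Nonempty := ⟨M, hM.le, by rwa [hX.cdf_top]⟩
  have hr : ContinuousWithinAt (cdf (P.map X)) (Ici (quantile P X t)) (quantile P X t) :=
    (cdf (P.map X)).right_continuous _
  have hev : ∀ᶠ y in 𝓝[>] (quantile P X t), cdf (P.map X) y < t :=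
    (hr.mono Ioi_subset_Ici_self).tendsto.eventually (gt_mem_nhds h)
  obtain ⟨y, hy, hy'⟩ := (hev.and self_mem_nhdsWithin).exists
  obtain ⟨z, hz, hzy⟩ := exists_lt_of_csInf_lt hne hy'
  exact absurd (hz.2.trans (monotone_cdf _ hzy.le)) (not_le.2 hy)

lemma LossAssumption.quantile_le_iff (hX : LossAssumption P X M) (hM : 0 < M) {t x : ℝ}
    (ht : t ≤ 1) (hx : 0 ≤ x) : quantile P X t ≤ x ↔ t ≤ cdf (P.map X) x :=
  ⟨fun h => (hX.le_cdf_quantile hM ht).trans (monotone_cdf _ h),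
    fun h => csInf_le (bddBelow_quantile_set P X t) ⟨hx, h⟩⟩

lemma LossAssumption.monotoneOn_quantile (hX : LossAssumption P X M) (hM : 0 < M) :
    MonotoneOn (quantile P X) (Icc 0 1) := fun _ hs _ ht hst =>
  (hX.quantile_le_iff hM hs.2 (quantile_nonneg _ _ _)).2
    (hst.trans (hX.le_cdf_quantile hM ht.2))

lemma LossAssumption.quantile_zero (hX : LossAssumption P X M) (hM : 0 < M) :
    quantile P X 0 = 0 :=
  le_antisymm ((hX.quantile_le_iff hM zero_le_one le_rfl).2 (cdf_nonneg _ _))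
    (quantile_nonneg _ _ _)

lemma LossAssumption.quantile_one (hX : LossAssumption P X M) (hM : 0 < M) :
    quantile P X 1 = M := by
  apply le_antisymm ((hX.quantile_le_iff hM le_rfl hM.le).2 hX.cdf_top.ge)
  by_contra! h
  have h1 := hX.strictMonoOn_cdf ⟨quantile_nonneg _ _ _, h.le⟩ ⟨hM.le, le_rfl⟩ h
  rw [hX.cdf_top] at h1
  exact absurd (hX.le_cdf_quantile hM le_rfl) (not_le.2 h1)

lemma LossAssumption.quantile_mem (hX : LossAssumption P X M) (hM : 0 < M) {t : ℝ}
    (ht : t ∈ Icc (0 : ℝ) 1) : quantile P X t ∈ Icc 0 M := by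
  refine ⟨quantile_nonneg _ _ _, ?_⟩
  rw [← hX.quantile_one hM]
  exact hX.monotoneOn_quantile hM ht ⟨zero_le_one, le_rfl⟩ ht.2

/-- Continuity of the quantile function lets equality of retained losses in quantile form determine
contracts at every point of `[0,M]`. -/
lemma LossAssumption.exists_quantile_eq (hX : LossAssumption P X M) (hM : 0 < M) {x : ℝ}
    (hx : x ∈ Icc 0 M) : ∃ t ∈ Icc (0 : ℝ) 1, quantile P X t = x := by
  have := intermediate_value_Icc zero_le_one hX.continuousOn_quantile
  rw [hX.quantile_zero hM, hX.quantile_one hM] at this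
  exact this hx

/-- The law of the loss is the image of the uniform distribution under the quantile function. -/
lemma LossAssumption.map_eq (hX : LossAssumption P X M) (hM : 0 < M) :
    P.map X = (volume.restrict (Ioc 0 1)).map (quantile P X) := by
  have := hX.isProbabilityMeasure_map
  refine Measure.ext_of_Iic _ _ fun x => ?_
  rw [Measure.map_apply_of_aemeasurable hX.aemeasurable_quantile measurableSet_Iic,
    Measure.restrict_apply' measurableSet_Ioc, ← ofReal_cdf]
  rcases lt_or_ge x 0 with hx | hx
  · have he : quantile P X ⁻¹' Iic x ∩ Ioc 0 1 = ∅ := by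
      ext t
      simp only [mem_inter_iff, mem_preimage, mem_Iic, mem_empty_iff_false, iff_false, not_and]
      intro h
      exact absurd ((quantile_nonneg P X t).trans h) (not_le.2 hx)
    rw [he, hX.cdf_of_neg hx]
    simp
  · have he : quantile P X ⁻¹' Iic x ∩ Ioc 0 1 = Ioc 0 (cdf (P.map X) x) := by
      ext t
      simp only [mem_inter_iff, mem_preimage, mem_Iic, mem_Ioc]
      constructor
      · rintro ⟨h, h0, h1⟩
        exact ⟨h0, (hX.quantile_le_iff hM h1 hx).1 h⟩
      · rintro ⟨h0, h⟩
        have h1 := h.trans (cdf_le_one _ _)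
        exact ⟨(hX.quantile_le_iff hM h1 hx).2 h, h0, h1⟩
    rw [he, Real.volume_Ioc, sub_zero]

/-- Equal values at `x < y` make the monotone quantile function constant on `(x,y]`, and that value
is then an atom of mass at least `y - x`. -/
lemma LossAssumption.eq_of_quantile_eq (hX : LossAssumption P X M) (hM : 0 < M) {r s : ℝ}
    (hr : r ∈ Icc (0 : ℝ) 1) (hs : s ∈ Icc (0 : ℝ) 1) (h : quantile P X r = quantile P X s)
    (h0 : P (X ⁻¹' {quantile P X s}) = 0) : r = s := by
  have key : ∀ x y, x ∈ Icc (0 : ℝ) 1 → y ∈ Icc (0 : ℝ) 1 → quantile P X x = quantile P X s →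
      quantile P X y = quantile P X s → ¬ x < y := by
    intro x y hx hy hxs hys hxy
    rw [← Measure.map_apply hX.measurable (measurableSet_singleton _), hX.map_eq hM,
      Measure.map_apply_of_aemeasurable hX.aemeasurable_quantile (measurableSet_singleton _),
      Measure.restrict_apply' measurableSet_Ioc] at h0
    have hsub : Ioc x y ⊆ quantile P X ⁻¹' {quantile P X s} ∩ Ioc 0 1 := by
      intro t ht
      have ht1 : t ∈ Icc (0 : ℝ) 1 := ⟨hx.1.trans ht.1.le, ht.2.trans hy.2⟩
      refine ⟨le_antisymm ?_ ?_, hx.1.trans_lt ht.1, ht1.2⟩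
      · exact hys ▸ hX.monotoneOn_quantile hM ht1 hy ht.2
      · exact hxs ▸ hX.monotoneOn_quantile hM hx ht1 ht.1.le
    have h1 := measure_mono_null hsub h0
    rw [Real.volume_Ioc, ENNReal.ofReal_eq_zero] at h1
    linarith
  exact le_antisymm (not_lt.1 (key _ _ hs hr rfl h)) (not_lt.1 (key _ _ hr hs h rfl))

lemma LossAssumption.ae_quantile_comp_clamp (hX : LossAssumption P X M) (hM : 0 < M)
    (φ : ℝ → ℝ) : (fun t => φ (quantile P X t)) =ᵐ[volume.restrict (Ioc 0 1)]
      fun t => φ (max 0 (min (quantile P X t) M)) := by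
  filter_upwards [ae_restrict_mem measurableSet_Ioc] with t ht
  rw [clamp_eq (hX.quantile_mem hM (Ioc_subset_Icc_self ht))]

/-- The law of a continuous function of the loss. -/
lemma LossAssumption.map_comp_eq (hX : LossAssumption P X M) (hM : 0 < M) {φ : ℝ → ℝ}
    (hφ : ContinuousOn φ (Icc 0 M)) :
    P.map (fun ω => φ (X ω)) = (volume.restrict (Ioc 0 1)).map fun t => φ (quantile P X t) := by
  have hc := continuous_comp_clamp hM hφ
  rw [Measure.map_congr (hX.ae_comp_clamp φ),
    Measure.map_congr (hX.ae_quantile_comp_clamp hM φ)]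
  have h1 := Measure.map_map (μ := P) hc.measurable hX.measurable
  have h2 := AEMeasurable.map_map_of_aemeasurable (μ := volume.restrict (Ioc 0 1))
    hc.measurable.aemeasurable hX.aemeasurable_quantile
  rw [hX.map_eq hM] at h1
  exact h1.symm.trans h2

/-- The expectation of a continuous function of the loss in quantile form. -/
lemma LossAssumption.integral_comp_eq (hX : LossAssumption P X M) (hM : 0 < M) {φ : ℝ → ℝ}
    (hφ : ContinuousOn φ (Icc 0 M)) :
    ∫ ω, φ (X ω) ∂P = ∫ t in (0 : ℝ)..1, φ (quantile P X t) := by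
  have hc := continuous_comp_clamp hM hφ
  rw [integral_congr_ae (hX.ae_comp_clamp φ), intervalIntegral.integral_of_le zero_le_one,
    integral_congr_ae (hX.ae_quantile_comp_clamp hM φ),
    ← integral_map (f := fun x => φ (max 0 (min x M))) hX.measurable.aemeasurable
      hc.aestronglyMeasurable,
    hX.map_eq hM, integral_map hX.aemeasurable_quantile hc.aestronglyMeasurable]

/-- An upper subset of `(0,1]` of length `p` is almost everywhere `(1-p,1]`. -/
lemma ae_eq_Ioc_of_upper {S : Set ℝ} {p : ℝ} (hp0 : 0 ≤ p) (hS : S ⊆ Ioc 0 1)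
    (hup : ∀ s ∈ S, ∀ t ≤ 1, s ≤ t → t ∈ S) (hvol : volume S = ENNReal.ofReal p) :
    S =ᵐ[volume] (Ioc (1 - p) 1 : Set ℝ) := by
  have h : ∀ᵐ t : ℝ, t ≠ 1 - p := by simp [ae_iff, measure_singleton]
  filter_upwards [h] with t ht
  apply propext
  change t ∈ S ↔ t ∈ Ioc (1 - p) 1
  constructor
  · intro hts
    have h1 : Icc t 1 ⊆ S := fun x hx => hup t hts x hx.2 hx.1
    have h2 := measure_mono (μ := volume) h1
    rw [hvol, Real.volume_Icc, ENNReal.ofReal_le_ofReal_iff hp0] at h2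
    exact ⟨lt_of_le_of_ne (by linarith) ht.symm, (hS hts).2⟩
  · intro htI
    by_contra hts
    have h1 : S ⊆ Ioc t 1 := by
      intro x hx
      refine ⟨?_, (hS hx).2⟩
      by_contra! hxt
      exact hts (hup x hx t htI.2 hxt)
    have h2 := measure_mono (μ := volume) h1
    rw [hvol, Real.volume_Ioc, ENNReal.ofReal_le_ofReal_iff (by linarith [htI.2])] at h2
    linarith [htI.1]

variable {T : ℝ → ℝ}

lemma lintegral_deriv_Ioc (hT : InverseSShaped T) {p : ℝ} (hp0 : 0 ≤ p) (hp1 : p ≤ 1) :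
    ∫⁻ t in Ioc (1 - p) 1, ENNReal.ofReal (deriv T t) = ENNReal.ofReal (1 - T (1 - p)) := by
  have hint : IntegrableOn (deriv T) (Ioc (1 - p) 1) :=
    (intervalIntegrable_iff_integrableOn_Ioc_of_le zero_le_one).1 hT.intervalIntegrable_deriv
      |>.mono_set (Ioc_subset_Ioc_left (by linarith))
  rw [← ofReal_integral_eq_lintegral_ofReal hint,
    ← intervalIntegral.integral_of_le (by linarith),
    hT.integral_deriv (by linarith) (by linarith) le_rfl, hT.map_one]
  filter_upwards [ae_restrict_mem measurableSet_Ioc,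
    ae_restrict_of_ae hT.ae_deriv_pos] with t ht h
  exact (h ⟨by linarith [ht.1], ht.2⟩).le

/-- The distorted law of an antitone function of the loss is the image of `T'(t) dt`. -/
lemma LossAssumption.measure_distortedCDF (hX : LossAssumption P X M) (hM : 0 < M)
    (hT : InverseSShaped T) {φ : ℝ → ℝ} (hφ : ContinuousOn φ (Icc 0 M))
    (hanti : AntitoneOn φ (Icc 0 M)) :
    (distortedCDF hT P fun ω => φ (X ω)).measure =
      ((volume.restrict (Ioc 0 1)).withDensity fun t => ENNReal.ofReal (deriv T t)).map
        fun t => φ (quantile P X t) := by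
  set Y : Ω → ℝ := fun ω => φ (X ω) with hY
  have hlaw := hX.map_comp_eq hM hφ
  have hg : AEMeasurable (fun t => φ (quantile P X t)) (volume.restrict (Ioc 0 1)) := by
    apply ContinuousOn.aemeasurable _ measurableSet_Ioc
    exact hφ.comp (hX.continuousOn_quantile.mono Ioc_subset_Icc_self)
      fun t ht => hX.quantile_mem hM (Ioc_subset_Icc_self ht)
  have hprob : IsProbabilityMeasure (P.map Y) := by
    refine Measure.isProbabilityMeasure_map ?_
    exact (((continuous_comp_clamp hM hφ).measurable.comp hX.measurable).aemeasurable).congr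
      (hX.ae_comp_clamp φ).symm
  have hsymm : Tendsto (fun x => 1 - cdf (P.map Y) x) atBot (𝓝[Icc 0 1] 1) := by
    refine tendsto_nhdsWithin_iff.2 ⟨?_, Eventually.of_forall fun x => ?_⟩
    · simpa using (tendsto_cdf_atBot (P.map Y)).const_sub 1
    · exact ⟨by linarith [cdf_le_one (P.map Y) x], by linarith [cdf_nonneg (P.map Y) x]⟩
  have hbot : Tendsto (distortedCDF hT P Y) atBot (𝓝 (-1)) := by
    have h := (hT.continuousOn 1 ⟨zero_le_one, le_rfl⟩).tendsto.comp hsymm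
    rw [hT.map_one] at h
    exact h.neg
  have hsymm' : Tendsto (fun x => 1 - cdf (P.map Y) x) atTop (𝓝[Icc 0 1] 0) := by
    refine tendsto_nhdsWithin_iff.2 ⟨?_, Eventually.of_forall fun x => ?_⟩
    · simpa using (tendsto_cdf_atTop (P.map Y)).const_sub 1
    · exact ⟨by linarith [cdf_le_one (P.map Y) x], by linarith [cdf_nonneg (P.map Y) x]⟩
  have htop : Tendsto (distortedCDF hT P Y) atTop (𝓝 0) := by
    have h := (hT.continuousOn 0 ⟨le_rfl, zero_le_one⟩).tendsto.comp hsymm'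
    rw [hT.map_zero] at h
    simpa using! h.neg
  have hfin : IsFiniteMeasure (distortedCDF hT P Y).measure :=
    (distortedCDF hT P Y).isFiniteMeasure hbot htop
  refine Measure.ext_of_Iic _ _ fun x => ?_
  have hp0 := cdf_nonneg (P.map Y) x
  have hp1 := cdf_le_one (P.map Y) x
  rw [StieltjesFunction.measure_Iic _ hbot, Measure.map_apply_of_aemeasurable
    (hg.mono_ac (withDensity_absolutelyContinuous _ _)) measurableSet_Iic,
    withDensity_apply', Measure.restrict_restrict' measurableSet_Ioc]
  -- As `φ ∘ Q` is antitone, its sublevel set is an upper subset of `(0,1]` whose length is the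
  -- probability of the sublevel event, and upper sets are determined by their length up to null
  -- sets.
  have hS : ((fun t => φ (quantile P X t)) ⁻¹' Iic x ∩ Ioc 0 1 : Set ℝ) =ᵐ[volume]
      (Ioc (1 - cdf (P.map Y) x) 1 : Set ℝ) := by
    apply ae_eq_Ioc_of_upper hp0 inter_subset_right
    · rintro s ⟨hs, hs0, hs1⟩ t ht hst
      have ht0 := hs0.trans_le hst
      refine ⟨?_, ht0, ht⟩
      refine le_trans (b := φ (quantile P X s)) ?_ hs
      exact hanti (hX.quantile_mem hM ⟨hs0.le, hs1⟩) (hX.quantile_mem hM ⟨ht0.le, ht⟩)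
        (hX.monotoneOn_quantile hM ⟨hs0.le, hs1⟩ ⟨ht0.le, ht⟩ hst)
    · rw [ofReal_cdf, hlaw, Measure.map_apply_of_aemeasurable hg measurableSet_Iic,
        Measure.restrict_apply' measurableSet_Ioc]
  rw [setLIntegral_congr hS, lintegral_deriv_Ioc hT hp0 hp1]
  congr 1
  change -T (1 - cdf (P.map Y) x) - -1 = _
  ring

/-- Rank-dependent utility in quantile form. -/
lemma LossAssumption.rdu_eq (hX : LossAssumption P X M) (hM : 0 < M)
    (hT : InverseSShaped T) {φ u v : ℝ → ℝ} (hφ : ContinuousOn φ (Icc 0 M))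
    (hanti : AntitoneOn φ (Icc 0 M)) (hnonneg : ∀ x ∈ Icc 0 M, 0 ≤ φ x)
    (hv : Continuous v) (huv : EqOn u v (Ici 0)) :
    rdu hT u P (fun ω => φ (X ω)) = ∫ t in (0 : ℝ)..1, v (φ (quantile P X t)) * deriv T t := by
  have hg : AEMeasurable (fun t => φ (quantile P X t)) (volume.restrict (Ioc 0 1)) := by
    apply ContinuousOn.aemeasurable _ measurableSet_Ioc
    exact hφ.comp (hX.continuousOn_quantile.mono Ioc_subset_Icc_self)
      fun t ht => hX.quantile_mem hM (Ioc_subset_Icc_self ht)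
  have hac := withDensity_absolutelyContinuous (volume.restrict (Ioc (0 : ℝ) 1))
    fun t => ENNReal.ofReal (deriv T t)
  have hg' := hg.mono_ac hac
  have hTm : AEMeasurable (fun t => ENNReal.ofReal (deriv T t)) (volume.restrict (Ioc 0 1)) :=
    (measurable_deriv T).ennreal_ofReal.aemeasurable
  -- The distorted law is carried by `[0,∞)` because `φ ≥ 0`. There `u` may be replaced by `v`,
  -- whose global continuity supplies measurability.
  rw [rdu, setIntegral_congr_fun measurableSet_Ici huv, hX.measure_distortedCDF hM hT hφ hanti,
    Measure.restrict_eq_self_of_ae_mem, integral_map hg' hv.aestronglyMeasurable,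
    integral_withDensity_eq_integral_toReal_smul₀ hTm (by simp),
    intervalIntegral.integral_of_le zero_le_one]
  · apply integral_congr_ae
    filter_upwards [ae_restrict_mem measurableSet_Ioc,
      ae_restrict_of_ae hT.ae_deriv_pos] with t ht h
    rw [ENNReal.toReal_ofReal (h ht).le, smul_eq_mul, mul_comm]
  · refine (ae_map_iff (p := (· ∈ Ici 0)) hg' measurableSet_Ici).2 ?_
    apply hac.ae_le
    filter_upwards [ae_restrict_mem measurableSet_Ioc] with t ht
    exact hnonneg _ (hX.quantile_mem hM (Ioc_subset_Icc_self ht))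

end Quantile

/-! ### Integrals against the weighting density -/

section Weighting

variable {T Q : ℝ → ℝ} {α a b : ℝ}

lemma InverseSShaped.intervalIntegrable_mul_deriv (hT : InverseSShaped T) {g : ℝ → ℝ}
    (hg : ContinuousOn g (Icc 0 1)) {x y : ℝ} (hx : x ∈ Icc (0 : ℝ) 1) (hy : y ∈ Icc (0 : ℝ) 1) :
    IntervalIntegrable (fun t => g t * deriv T t) volume x y := by
  have h : IntervalIntegrable (fun t => g t * deriv T t) volume 0 1 :=
    hT.intervalIntegrable_deriv.continuousOn_mul (by rwa [uIcc_of_le zero_le_one])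
  apply h.mono_set
  rw [uIcc_of_le zero_le_one]
  exact uIcc_subset_Icc hx hy

/-- If the curvature of `T` dominates that of `exp (α Q)`, then `exp (α Q) T'` is strictly
decreasing. -/
lemma InverseSShaped.strictAntiOn_exp_mul_deriv (hT : InverseSShaped T)
    (hQ : AbsolutelyContinuousOnInterval Q 0 1) (hab : a < b) (hb : b < 1)
    (hanti : StrictAntiOn (deriv T) (Ioc 0 b))
    (hdom : ∀ z ∈ Ioc 0 a, DifferentiableAt ℝ Q z → α * deriv Q z < arrowPratt T z) :
    StrictAntiOn (fun t => Real.exp (α * Q t) * deriv T t) (Ioc 0 a) := by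
  intro x hx y hy hxy
  have hpos : ∀ t ∈ Ioc 0 a, 0 < deriv T t := fun t ht =>
    hT.deriv_pos_of_lt hb hanti ⟨ht.1, ht.2.trans_lt hab⟩
  have hsub : Icc x y ⊆ Ioc 0 a := fun t ht => ⟨hx.1.trans_le ht.1, ht.2.trans hy.2⟩
  -- Passing to logarithms turns the claim into a comparison of the integrals of `α Q'` and `A_T`.
  have hder : ∀ t ∈ Ioc 0 a, HasDerivAt (fun s => -Real.log (deriv T s)) (arrowPratt T t) t := by
    intro t ht
    have h := (hT.differentiableOn_deriv.differentiableAt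
      (Ioo_mem_nhds ht.1 ((ht.2.trans_lt hab).trans hb))).hasDerivAt
    refine (h.log (hpos t ht).ne').neg.congr_deriv ?_
    rw [arrowPratt, neg_div]
  -- `T''` need not be continuous; integrability of `A_T` follows from its being the derivative of a
  -- monotone function.
  have hmono : MonotoneOn (fun s => -Real.log (deriv T s)) (uIcc x y) := by
    rw [uIcc_of_le hxy.le]
    intro s hs t ht hst
    apply neg_le_neg
    apply Real.log_le_log (hpos t (hsub ht))
    exact hanti.antitoneOn ⟨(hsub hs).1, (hsub hs).2.trans hab.le⟩
      ⟨(hsub ht).1, (hsub ht).2.trans hab.le⟩ hst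
  have hint1 : IntervalIntegrable (arrowPratt T) volume x y := by
    refine hmono.intervalIntegrable_deriv.congr fun t ht => ?_
    rw [uIoc_of_le hxy.le] at ht
    exact (hder t (hsub (Ioc_subset_Icc_self ht))).deriv
  have hftc1 : ∫ t in x..y, arrowPratt T t = -Real.log (deriv T y) - -Real.log (deriv T x) := by
    apply intervalIntegral.integral_eq_sub_of_hasDerivAt _ hint1
    intro t ht
    rw [uIcc_of_le hxy.le] at ht
    exact hder t (hsub ht)
  have hQ' : AbsolutelyContinuousOnInterval Q x y := by
    apply hQ.mono
    rw [uIcc_of_le zero_le_one, uIcc_of_le hxy.le]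
    exact Icc_subset_Icc hx.1.le (hy.2.trans (hab.trans hb).le)
  have hint2 := hQ'.intervalIntegrable_deriv.const_mul α
  have hftc2 : ∫ t in x..y, α * deriv Q t = α * (Q y - Q x) := by
    rw [intervalIntegral.integral_const_mul, hQ'.integral_deriv_eq_sub]
  -- Dominance is assumed only where `Q` is differentiable, which absolute continuity makes almost
  -- everywhere.
  have hae : ∀ᵐ t ∂(volume.restrict (Ioc x y)), α * deriv Q t < arrowPratt T t := by
    filter_upwards [ae_restrict_mem measurableSet_Ioc, ae_restrict_of_ae hQ'.ae_differentiableAt]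
      with t ht hd
    rw [uIcc_of_le hxy.le] at hd
    exact hdom t (hsub (Ioc_subset_Icc_self ht)) (hd (Ioc_subset_Icc_self ht))
  have hlt : ∫ t in x..y, α * deriv Q t < ∫ t in x..y, arrowPratt T t := by
    apply intervalIntegral.integral_lt_integral_of_ae_le_of_measure_setOfPred_lt_ne_zero hxy.le
      hint2 hint1 (hae.mono fun t ht => ht.le)
    rw [measure_eq_measure_of_null_sdiff (subset_univ _) (by rwa [← compl_eq_univ_sdiff])]
    simp [hxy]
  rw [hftc1, hftc2] at hlt
  have hlog : ∀ t ∈ Ioc 0 a, Real.exp (α * Q t) * deriv T t =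
      Real.exp (α * Q t + Real.log (deriv T t)) := by
    intro t ht
    rw [Real.exp_add, Real.exp_log (hpos t ht)]
  simp only [hlog x hx, hlog y hy]
  apply Real.exp_lt_exp.2
  linarith

end Weighting

/-- The analytic setting of the contracting problem: a weighting function with turning point `a`
and an absolutely continuous increasing `Q` such that `exp (α Q) T'` decreases on `(0,a]`. -/
structure RetentionSetting (T Q : ℝ → ℝ) (α a : ℝ) : Prop where
  weighting : InverseSShaped T
  turning : IsTurningPoint T a
  deriv_turning : deriv T a = chordSlope T a
  strictAntiOn_deriv : StrictAntiOn (deriv T) (Ioc 0 a)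
  pos : 0 < α
  absCont : AbsolutelyContinuousOnInterval Q 0 1
  monotoneOn : MonotoneOn Q (Icc 0 1)
  strictAntiOn_exp : StrictAntiOn (fun t => Real.exp (α * Q t) * deriv T t) (Ioc 0 a)

/-- The left-hand side of the equation that couples the two thresholds, up to a constant. -/
noncomputable def gap (T Q : ℝ → ℝ) (α z₂ z₁ : ℝ) : ℝ :=
  ∫ t in z₂..z₁, (Real.exp (α * (Q z₁ - Q z₂)) * chordSlope T z₁
    - Real.exp (α * (Q t - Q z₂)) * deriv T t)

/-! ### The gap: monotonicity in the upper level and its zeros. -/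

namespace RetentionSetting

variable {T Q : ℝ → ℝ} {α a : ℝ}

lemma continuousOn (h : RetentionSetting T Q α a) : ContinuousOn Q (Icc 0 1) := by
  have := h.absCont.continuousOn
  rwa [uIcc_of_le zero_le_one] at this

lemma continuousOn_exp (h : RetentionSetting T Q α a) (q : ℝ) :
    ContinuousOn (fun t => Real.exp (α * (Q t - q))) (Icc 0 1) :=
  (continuousOn_const.mul (h.continuousOn.sub continuousOn_const)).rexp

lemma intervalIntegrable_exp (h : RetentionSetting T Q α a) (q : ℝ) {x y : ℝ}
    (hx : x ∈ Icc (0 : ℝ) 1) (hy : y ∈ Icc (0 : ℝ) 1) :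
    IntervalIntegrable (fun t => Real.exp (α * (Q t - q)) * deriv T t) volume x y :=
  h.weighting.intervalIntegrable_mul_deriv (h.continuousOn_exp q) hx hy

lemma Ioo_turning (h : RetentionSetting T Q α a) : 0 < a ∧ a < 1 := h.turning.1

lemma gap_eq_sub (h : RetentionSetting T Q α a) {z₂ z₁ : ℝ} (hz₂ : z₂ ∈ Icc (0 : ℝ) 1)
    (hz₁ : z₁ ∈ Icc (0 : ℝ) 1) :
    gap T Q α z₂ z₁ = (z₁ - z₂) * (Real.exp (α * (Q z₁ - Q z₂)) * chordSlope T z₁) -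
      ∫ t in z₂..z₁, Real.exp (α * (Q t - Q z₂)) * deriv T t := by
  rw [gap, intervalIntegral.integral_sub intervalIntegrable_const
    (h.intervalIntegrable_exp _ hz₂ hz₁), intervalIntegral.integral_const, smul_eq_mul]

/-- Splitting off the factor `exp (-α Q z₂)` leaves a fixed primitive evaluated at the two levels,
so continuity in each level can be read off. -/
lemma gap_eq (h : RetentionSetting T Q α a) {z₂ z₁ : ℝ} (hz₂ : z₂ ∈ Icc (0 : ℝ) 1)
    (hz₁ : z₁ ∈ Icc (0 : ℝ) 1) :
    gap T Q α z₂ z₁ = (z₁ - z₂) * (Real.exp (α * (Q z₁ - Q z₂)) * chordSlope T z₁) -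
      Real.exp (-(α * Q z₂)) * ((∫ t in (0 : ℝ)..z₁, Real.exp (α * (Q t - 0)) * deriv T t) -
        ∫ t in (0 : ℝ)..z₂, Real.exp (α * (Q t - 0)) * deriv T t) := by
  have h0 : (0 : ℝ) ∈ Icc (0 : ℝ) 1 := ⟨le_rfl, zero_le_one⟩
  rw [h.gap_eq_sub hz₂ hz₁, intervalIntegral.integral_interval_sub_left
    (h.intervalIntegrable_exp 0 h0 hz₁) (h.intervalIntegrable_exp 0 h0 hz₂),
    ← intervalIntegral.integral_const_mul]
  congr 1
  apply intervalIntegral.integral_congr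
  intro t _
  simp only
  rw [← mul_assoc, ← Real.exp_add]
  congr 2
  ring

lemma continuousOn_primitive (h : RetentionSetting T Q α a) :
    ContinuousOn (fun z => ∫ t in (0 : ℝ)..z, Real.exp (α * (Q t - 0)) * deriv T t)
      (Icc 0 1) := by
  have h0 : (0 : ℝ) ∈ Icc (0 : ℝ) 1 := ⟨le_rfl, zero_le_one⟩
  have h1 : (1 : ℝ) ∈ Icc (0 : ℝ) 1 := ⟨zero_le_one, le_rfl⟩
  have := ((h.intervalIntegrable_exp 0 h0 h1).absolutelyContinuousOnInterval_intervalIntegral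
    (c := 0) (by simp)).continuousOn
  rwa [uIcc_of_le zero_le_one] at this

lemma continuousOn_gap_right (h : RetentionSetting T Q α a) {z₂ : ℝ} (hz₂ : z₂ ∈ Icc (0 : ℝ) 1) :
    ContinuousOn (gap T Q α z₂) (Ico 0 1) := by
  have hsub : Ico (0 : ℝ) 1 ⊆ Icc 0 1 := Ico_subset_Icc_self
  refine ContinuousOn.congr ?_ fun z hz => h.gap_eq hz₂ (hsub hz)
  exact ((continuousOn_id.sub continuousOn_const).mul
    (((h.continuousOn_exp _).mono hsub).mul h.weighting.continuousOn_chordSlope)).sub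
    (continuousOn_const.mul ((h.continuousOn_primitive.mono hsub).sub continuousOn_const))

lemma continuousOn_gap_left (h : RetentionSetting T Q α a) {z₁ : ℝ} (hz₁ : z₁ ∈ Icc (0 : ℝ) 1) :
    ContinuousOn (fun z₂ => gap T Q α z₂ z₁) (Icc 0 1) := by
  refine ContinuousOn.congr ?_ fun z hz => h.gap_eq hz hz₁
  have hQ := h.continuousOn
  have hP := h.continuousOn_primitive
  exact ((continuousOn_const.sub continuousOn_id).mul
    ((continuousOn_const.mul (continuousOn_const.sub hQ)).rexp.mul continuousOn_const)).sub
    (((continuousOn_const.mul hQ).neg).rexp.mul (continuousOn_const.sub hP))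

/-- Bounding the weighted integral by the largest value of its exponential factor. -/
lemma integral_mul_deriv_le (hT : InverseSShaped T) {g : ℝ → ℝ} (hg : ContinuousOn g (Icc 0 1))
    {x y C : ℝ} (hx : 0 ≤ x) (hxy : x ≤ y) (hy : y ≤ 1) (hC : ∀ t ∈ Ioc x y, g t ≤ C) :
    ∫ t in x..y, g t * deriv T t ≤ C * (T y - T x) := by
  have hx' : x ∈ Icc (0 : ℝ) 1 := ⟨hx, hxy.trans hy⟩
  have hy' : y ∈ Icc (0 : ℝ) 1 := ⟨hx.trans hxy, hy⟩
  rw [← hT.integral_deriv hx hxy hy, ← intervalIntegral.integral_const_mul]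
  apply intervalIntegral.integral_mono_ae_restrict hxy
    (hT.intervalIntegrable_mul_deriv hg hx' hy')
    (hT.intervalIntegrable_mul_deriv continuousOn_const hx' hy')
  have h0 : ∀ᵐ t : ℝ, t ≠ x := by simp [ae_iff, measure_singleton]
  filter_upwards [ae_restrict_mem measurableSet_Icc, ae_restrict_of_ae hT.ae_deriv_pos,
    ae_restrict_of_ae h0] with t ht hpos hne
  have ht' : t ∈ Ioc x y := ⟨lt_of_le_of_ne ht.1 hne.symm, ht.2⟩
  exact mul_le_mul_of_nonneg_right (hC t ht') (hpos ⟨hx.trans_lt ht'.1, ht.2.trans hy⟩).le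

lemma exp_le (h : RetentionSetting T Q α a) (q : ℝ) {s t : ℝ} (hs : 0 ≤ s) (hst : s ≤ t)
    (ht : t ≤ 1) : Real.exp (α * (Q s - q)) ≤ Real.exp (α * (Q t - q)) := by
  apply Real.exp_le_exp.2
  apply mul_le_mul_of_nonneg_left _ h.pos.le
  linarith [h.monotoneOn ⟨hs, hst.trans ht⟩ ⟨hs.trans hst, ht⟩ hst]

lemma integral_exp_le (h : RetentionSetting T Q α a) (q : ℝ) {x y : ℝ} (hx : 0 ≤ x) (hxy : x ≤ y)
    (hy : y ≤ 1) : ∫ t in x..y, Real.exp (α * (Q t - q)) * deriv T t ≤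
      Real.exp (α * (Q y - q)) * (T y - T x) :=
  integral_mul_deriv_le h.weighting (h.continuousOn_exp q) hx hxy hy
    fun _ ht => h.exp_le q (hx.trans ht.1.le) ht.2 hy

/-- Write `E` for the exponential factor. The new piece of the integral is at most `E y * (T y - T
x)`, and `T y - T x = f x (1 - x) - f y (1 - y)`. The gap therefore grows by at least `E y (1 - z₂)
(f y - f x) + (x - z₂) f x (E y - E x)`, whose first term is positive to the right of the turning
point and whose second is nonnegative. -/
lemma strictMonoOn_gap (h : RetentionSetting T Q α a) {z₂ : ℝ} (hz₂ : z₂ ∈ Icc 0 a) :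
    StrictMonoOn (gap T Q α z₂) (Ico a 1) := by
  intro x hx y hy hxy
  have ⟨ha0, ha1⟩ := h.Ioo_turning
  have hz₂' : z₂ ∈ Icc (0 : ℝ) 1 := ⟨hz₂.1, hz₂.2.trans ha1.le⟩
  have hx' : x ∈ Icc (0 : ℝ) 1 := ⟨ha0.le.trans hx.1, hx.2.le⟩
  have hy' : y ∈ Icc (0 : ℝ) 1 := ⟨ha0.le.trans hy.1, hy.2.le⟩
  rw [h.gap_eq_sub hz₂' hx', h.gap_eq_sub hz₂' hy',
    ← intervalIntegral.integral_add_adjacent_intervals (h.intervalIntegrable_exp _ hz₂' hx')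
      (h.intervalIntegrable_exp _ hx' hy')]
  have h1 := h.integral_exp_le (Q z₂) hx'.1 hxy.le hy'.2
  have h2 := h.exp_le (Q z₂) hx'.1 hxy.le hy'.2
  have h3 := h.turning.2.2 hx hy hxy
  have h4 := InverseSShaped.chordSlope_mul T hx.2
  have h5 := InverseSShaped.chordSlope_mul T hy.2
  have h6 := h.weighting.chordSlope_pos (z := x) ⟨hx'.1, hx.2⟩
  have hE : 0 < Real.exp (α * (Q y - Q z₂)) := Real.exp_pos _
  have hTT : T y - T x = chordSlope T x * (1 - x) - chordSlope T y * (1 - y) := by linarith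
  rw [hTT] at h1
  set Ex := Real.exp (α * (Q x - Q z₂))
  set Ey := Real.exp (α * (Q y - Q z₂))
  have h7 : 0 < Ey * (1 - z₂) * (chordSlope T y - chordSlope T x) :=
    mul_pos (mul_pos hE (by linarith [hz₂.2])) (sub_pos.2 h3)
  have h8 : 0 ≤ (x - z₂) * chordSlope T x * (Ey - Ex) :=
    mul_nonneg (mul_nonneg (by linarith [hz₂.2, hx.1]) h6.le) (by linarith)
  nlinarith

/-- `exp (α (Q - q)) T'` is strictly decreasing on `(0,a]`. -/
lemma strictAntiOn_exp_sub (h : RetentionSetting T Q α a) (q : ℝ) :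
    StrictAntiOn (fun t => Real.exp (α * (Q t - q)) * deriv T t) (Ioc 0 a) := by
  intro x hx y hy hxy
  have h1 := mul_lt_mul_of_pos_left (h.strictAntiOn_exp hx hy hxy) (Real.exp_pos (-(α * q)))
  simp only [← mul_assoc, ← Real.exp_add] at h1
  convert h1 using 3 <;> ring

/-- Since `f a = T' a`, the integrand compares the decreasing function `exp (α (Q - Q z₂)) T'` at
`a` with its larger values before `a`. -/
lemma gap_turning_nonpos (h : RetentionSetting T Q α a) {z₂ : ℝ} (hz₂ : z₂ ∈ Icc 0 a) :
    gap T Q α z₂ a ≤ 0 := by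
  have ⟨ha0, ha1⟩ := h.Ioo_turning
  have h1 : 0 ≤ -gap T Q α z₂ a := by
    rw [gap, ← intervalIntegral.integral_neg, intervalIntegral.integral_of_le hz₂.2]
    apply setIntegral_nonneg measurableSet_Ioc
    intro t ht
    have := (h.strictAntiOn_exp_sub (Q z₂)).antitoneOn ⟨hz₂.1.trans_lt ht.1, ht.2⟩
      ⟨ha0, le_rfl⟩ ht.2
    rw [← h.deriv_turning]
    linarith
  linarith

/-- In this bound `Q` enters only through a positive factor, so nonnegativity of the gap can be
checked on `T` alone. -/
lemma gap_ge (h : RetentionSetting T Q α a) {z₂ z₁ : ℝ} (hz₂ : 0 ≤ z₂) (hz : z₂ ≤ z₁)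
    (hz₁ : z₁ ≤ 1) : Real.exp (α * (Q z₁ - Q z₂)) *
      ((z₁ - z₂) * chordSlope T z₁ - (T z₁ - T z₂)) ≤ gap T Q α z₂ z₁ := by
  rw [h.gap_eq_sub ⟨hz₂, hz.trans hz₁⟩ ⟨hz₂.trans hz, hz₁⟩]
  linarith [h.integral_exp_le (Q z₂) hz₂ hz hz₁]

lemma exists_gap_eq_zero_of_nonneg (h : RetentionSetting T Q α a) {z₂ y : ℝ} (hz₂ : z₂ ∈ Icc 0 a)
    (hy : y ∈ Ico a 1) (hgap : 0 ≤ gap T Q α z₂ y) : ∃ z ∈ Icc a y, gap T Q α z₂ z = 0 := by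
  have ⟨ha0, ha1⟩ := h.Ioo_turning
  exact intermediate_value_Icc hy.1
    ((h.continuousOn_gap_right ⟨hz₂.1, hz₂.2.trans ha1.le⟩).mono
      fun t ht => ⟨ha0.le.trans ht.1, ht.2.trans_lt hy.2⟩)
    ⟨h.gap_turning_nonpos hz₂, hgap⟩

lemma exists_gap_eq_zero (h : RetentionSetting T Q α a) {z₂ : ℝ} (hz₂ : z₂ ∈ Icc 0 a) :
    ∃ z ∈ Ico a 1, gap T Q α z₂ z = 0 := by
  have ⟨ha0, ha1⟩ := h.Ioo_turning
  -- With `y > (1 + a) / 2` and `f y ≥ 2 / (1 - a)`, the product `(y - z₂) f y` is at least `1`,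
  -- which exceeds any increment of `T`.
  obtain ⟨y, hy1, hy2⟩ := ((h.weighting.tendsto_chordSlope.eventually_ge_atTop (2 / (1 - a))).and
    (Ioo_mem_nhdsLT (show (1 + a) / 2 < 1 by linarith))).exists
  have hya : a ≤ y := by linarith [hy2.1]
  have hgap : 0 ≤ gap T Q α z₂ y := by
    refine le_trans (mul_nonneg (Real.exp_pos _).le ?_) (h.gap_ge hz₂.1 (hz₂.2.trans hya) hy2.2.le)
    have h1 : (1 - a) / 2 * (2 / (1 - a)) ≤ (y - z₂) * chordSlope T y := by
      have : 0 < 1 - a := by linarith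
      apply mul_le_mul (by linarith [hy2.1, hz₂.2]) hy1 (by positivity)
      linarith [hz₂.2]
    have h2 : (1 - a) / 2 * (2 / (1 - a)) = 1 := by
      have : 1 - a ≠ 0 := by linarith
      field_simp
    have h3 := (h.weighting.mem_Icc (x := y) ⟨ha0.le.trans hya, hy2.2.le⟩).2
    have h4 := (h.weighting.mem_Icc (x := z₂) ⟨hz₂.1, hz₂.2.trans ha1.le⟩).1
    linarith
  obtain ⟨z, hz, e⟩ := h.exists_gap_eq_zero_of_nonneg hz₂ ⟨hya, hy2.2⟩ hgap
  exact ⟨z, ⟨hz.1, hz.2.trans_lt hy2.2⟩, e⟩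

/-- The zero of the gap depends continuously on the lower level. -/
lemma exists_continuousOn_zero (h : RetentionSetting T Q α a) : ∃ ζ : ℝ → ℝ,
    (∀ z ∈ Icc 0 a, ζ z ∈ Ico a 1 ∧ gap T Q α z (ζ z) = 0) ∧ ContinuousOn ζ (Icc 0 a) := by
  have ⟨ha0, ha1⟩ := h.Ioo_turning
  have hex : ∀ z, ∃ y, z ∈ Icc 0 a → y ∈ Ico a 1 ∧ gap T Q α z y = 0 := by
    intro z
    by_cases hz : z ∈ Icc 0 a
    · obtain ⟨y, hy, e⟩ := h.exists_gap_eq_zero hz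
      exact ⟨y, fun _ => ⟨hy, e⟩⟩
    · exact ⟨0, fun h' => absurd h' hz⟩
  choose ζ hζ using hex
  -- By strict monotonicity, `y < ζ z` holds exactly when the gap at `(z, y)` is negative, an open
  -- condition on `z`; the upper bound is symmetric. Values of `y` outside `[a,1)` are trivial.
  refine ⟨ζ, hζ, fun x hx => tendsto_order.2 ⟨fun y hy => ?_, fun y hy => ?_⟩⟩
  · rcases lt_or_ge y a with hya | hya
    · filter_upwards [self_mem_nhdsWithin] with z hz using hya.trans_le (hζ z hz).1.1
    · have hy' : y ∈ Ico a 1 := ⟨hya, hy.trans (hζ x hx).1.2⟩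
      have h1 : gap T Q α x y < 0 := by
        rw [← (hζ x hx).2]
        exact h.strictMonoOn_gap hx hy' (hζ x hx).1 hy
      have hc : ContinuousWithinAt (fun z => gap T Q α z y) (Icc 0 a) x :=
        ((h.continuousOn_gap_left ⟨ha0.le.trans hya, hy'.2.le⟩).mono
          (Icc_subset_Icc_right ha1.le)) x hx
      filter_upwards [self_mem_nhdsWithin, hc.tendsto.eventually (gt_mem_nhds h1)] with z hz h2
      rw [← (hζ z hz).2] at h2
      exact ((h.strictMonoOn_gap hz).lt_iff_lt hy' (hζ z hz).1).1 h2
  · rcases le_or_gt 1 y with hy1 | hy1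
    · filter_upwards [self_mem_nhdsWithin] with z hz using (hζ z hz).1.2.trans_le hy1
    · have hy' : y ∈ Ico a 1 := ⟨(hζ x hx).1.1.trans hy.le, hy1⟩
      have h1 : 0 < gap T Q α x y := by
        rw [← (hζ x hx).2]
        exact h.strictMonoOn_gap hx (hζ x hx).1 hy' hy
      have hc : ContinuousWithinAt (fun z => gap T Q α z y) (Icc 0 a) x :=
        ((h.continuousOn_gap_left ⟨ha0.le.trans hy'.1, hy'.2.le⟩).mono
          (Icc_subset_Icc_right ha1.le)) x hx
      filter_upwards [self_mem_nhdsWithin, hc.tendsto.eventually (lt_mem_nhds h1)] with z hz h2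
      rw [← (hζ z hz).2] at h2
      exact ((h.strictMonoOn_gap hz).lt_iff_lt (hζ z hz).1 hy').1 h2

lemma gap_self (T Q : ℝ → ℝ) (α z : ℝ) : gap T Q α z z = 0 := by simp [gap]

lemma eq_turning_of_gap (h : RetentionSetting T Q α a) {z₁ : ℝ} (hz₁ : z₁ ∈ Ico a 1)
    (hgap : gap T Q α a z₁ = 0) : z₁ = a :=
  (h.strictMonoOn_gap ⟨h.Ioo_turning.1.le, le_rfl⟩).injOn hz₁ ⟨le_rfl, h.Ioo_turning.2⟩
    (hgap.trans (gap_self T Q α a).symm)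

/-- The unique zero of the gap at the lower level `0` lies between `a` and the crossing point. -/
lemma exists_unique_level (h : RetentionSetting T Q α a) {c : ℝ} (hc : IsCrossingPoint T a c) :
    ∃ l ∈ Icc a c, ∀ z, (z ∈ Icc a c ∧ gap T Q α 0 z = 0) ↔ z = l := by
  have ⟨ha0, ha1⟩ := h.Ioo_turning
  have hz : (0 : ℝ) ∈ Icc 0 a := ⟨le_rfl, ha0.le⟩
  have hTc := InverseSShaped.chordSlope_mul T hc.1.2
  rw [hc.2] at hTc
  -- At the crossing point `T c = c` and `f c = 1`, so the lower bound of `gap_ge` is exactly zero.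
  have hgap : 0 ≤ gap T Q α 0 c := by
    refine le_trans (le_of_eq ?_) (h.gap_ge le_rfl (ha0.le.trans hc.1.1.le) hc.1.2.le)
    rw [hc.2, h.weighting.map_zero]
    have : T c = c := by linarith
    rw [this]
    ring
  obtain ⟨l, hl, e⟩ := h.exists_gap_eq_zero_of_nonneg hz ⟨hc.1.1.le, hc.1.2⟩ hgap
  refine ⟨l, hl, fun z => ⟨fun ⟨hz1, hz2⟩ => ?_, fun hz => hz ▸ ⟨hl, e⟩⟩⟩
  exact (h.strictMonoOn_gap hz).injOn ⟨hz1.1, hz1.2.trans_lt hc.1.2⟩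
    ⟨hl.1, hl.2.trans_lt hc.1.2⟩ (hz2.trans e.symm)

end RetentionSetting

/-! ### Retained layers and the first-order condition -/

/-- The part of the loss `x` that falls between `q₂` and `q₁`. -/
def layer (q₂ q₁ x : ℝ) : ℝ := max (x - q₂) 0 - max (x - q₁) 0

section Layer

variable {q₂ q₁ x y : ℝ}

lemma layer_of_le (hq : q₂ ≤ q₁) (hx : x ≤ q₂) : layer q₂ q₁ x = 0 := by
  rw [layer, max_eq_right (by linarith), max_eq_right (by linarith), sub_zero]

lemma layer_of_mem (h₂ : q₂ ≤ x) (h₁ : x ≤ q₁) : layer q₂ q₁ x = x - q₂ := by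
  rw [layer, max_eq_left (by linarith), max_eq_right (by linarith), sub_zero]

lemma layer_of_ge (hq : q₂ ≤ q₁) (hx : q₁ ≤ x) : layer q₂ q₁ x = q₁ - q₂ := by
  rw [layer, max_eq_left (by linarith), max_eq_left (by linarith)]
  ring

lemma layer_sub_mem (hq : q₂ ≤ q₁) (hxy : x ≤ y) :
    0 ≤ layer q₂ q₁ y - layer q₂ q₁ x ∧ layer q₂ q₁ y - layer q₂ q₁ x ≤ y - x := by
  unfold layer
  grind

lemma layer_le (hq : q₂ ≤ q₁) (x : ℝ) : layer q₂ q₁ x ≤ q₁ - q₂ := by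
  unfold layer
  grind

lemma continuous_layer (q₂ q₁ : ℝ) : Continuous (layer q₂ q₁) := by
  unfold layer
  fun_prop

lemma threefold_eq (hq : q₂ ≤ q₁) (x : ℝ) : threefold q₂ q₁ x = x - layer q₂ q₁ x := by
  unfold threefold layer
  grind

lemma deductible_eq (hq : 0 ≤ q₁) (hx : 0 ≤ x) : deductible q₁ x = x - layer 0 q₁ x := by
  unfold deductible layer
  grind

end Layer

/-- Absolute continuity passes to functions whose increments are dominated. -/
lemma absolutelyContinuousOnInterval_of_dist_le {Q D : ℝ → ℝ} {x y : ℝ}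
    (hQ : AbsolutelyContinuousOnInterval Q x y)
    (hD : ∀ s ∈ uIcc x y, ∀ t ∈ uIcc x y, dist (D s) (D t) ≤ dist (Q s) (Q t)) :
    AbsolutelyContinuousOnInterval D x y := by
  rw [absolutelyContinuousOnInterval_iff] at hQ ⊢
  intro ε hε
  obtain ⟨δ, hδ, h⟩ := hQ ε hε
  refine ⟨δ, hδ, fun E hE hlen => lt_of_le_of_lt (Finset.sum_le_sum fun i hi => ?_) (h E hE hlen)⟩
  exact hD _ (hE.1 i hi).1 _ (hE.1 i hi).2

lemma deriv_nonneg_of_monotoneOn {D : ℝ → ℝ} {x y t : ℝ} (hD : MonotoneOn D (Icc x y))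
    (ht : t ∈ Ioo x y) : 0 ≤ deriv D t := by
  rw [← derivWithin_of_mem_nhds (Icc_mem_nhds ht.1 ht.2)]
  exact hD.derivWithin_nonneg

lemma deriv_nonpos_of_antitoneOn {D : ℝ → ℝ} {x y t : ℝ} (hD : AntitoneOn D (Icc x y))
    (ht : t ∈ Ioo x y) : deriv D t ≤ 0 := by
  rw [← derivWithin_of_mem_nhds (Icc_mem_nhds ht.1 ht.2)]
  exact hD.derivWithin_nonpos

/-- Integration by parts, with a sign condition on each of three subintervals. -/
lemma integral_mul_nonneg_of_piecewise_monotone {n D : ℝ → ℝ} {z₂ z₁ : ℝ}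
    (hn : IntervalIntegrable n volume 0 1) (hD : AbsolutelyContinuousOnInterval D 0 1)
    (hD0 : D 0 = 0)
    (hD₁ : MonotoneOn D (Icc 0 z₂)) (hN₁ : ∀ z ∈ Ioo 0 z₂, 0 ≤ ∫ t in z..1, n t)
    (hD₂ : AntitoneOn D (Icc z₂ z₁)) (hN₂ : ∀ z ∈ Icc z₂ z₁, ∫ t in z..1, n t ≤ 0)
    (hD₃ : MonotoneOn D (Icc z₁ 1)) (hN₃ : ∀ z ∈ Icc z₁ 1, 0 ≤ ∫ t in z..1, n t) :
    0 ≤ ∫ t in (0 : ℝ)..1, n t * D t := by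
  have hF := hn.absolutelyContinuousOnInterval_intervalIntegral (c := 0) (by simp)
  have hparts := hF.integral_mul_deriv_eq_deriv_mul hD
  have hderiv : ∫ t in (0 : ℝ)..1, deriv (fun x => ∫ v in (0 : ℝ)..x, n v) t * D t =
      ∫ t in (0 : ℝ)..1, n t * D t := by
    apply intervalIntegral.integral_congr_ae
    filter_upwards [hn.ae_hasDerivAt_integral] with t ht ht'
    rw [(ht (uIoc_subset_uIcc ht') 0 (by simp)).deriv]
  have hftc := hD.integral_deriv_eq_sub
  have hDint := hD.intervalIntegrable_deriv
  have hFD : IntervalIntegrable (fun t => (∫ v in (0 : ℝ)..t, n v) * deriv D t) volume 0 1 :=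
    hDint.continuousOn_mul hF.continuousOn
  -- Because `D 0 = 0`, integration by parts leaves the tail integral of `n` against `D'`.
  have hkey : ∫ t in (0 : ℝ)..1, n t * D t = ∫ t in (0 : ℝ)..1,
      ((∫ v in (0 : ℝ)..1, n v) * deriv D t - (∫ v in (0 : ℝ)..t, n v) * deriv D t) := by
    rw [intervalIntegral.integral_sub (hDint.const_mul _) hFD,
      intervalIntegral.integral_const_mul, hftc, hparts, hderiv, hD0]
    simp
  rw [hkey, intervalIntegral.integral_of_le zero_le_one]
  apply setIntegral_nonneg_of_ae_restrict
  have h : ∀ᵐ t : ℝ, t ≠ z₂ ∧ t ≠ z₁ ∧ t ≠ 1 := by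
    simp only [eventually_and]
    refine ⟨?_, ?_, ?_⟩ <;> simp [ae_iff, measure_singleton]
  filter_upwards [ae_restrict_mem measurableSet_Ioc, ae_restrict_of_ae h] with t ht hne
  have hsplit : (∫ v in (0 : ℝ)..1, n v) - (∫ v in (0 : ℝ)..t, n v) = ∫ v in t..1, n v := by
    apply intervalIntegral.integral_interval_sub_left hn
    apply hn.mono_set
    rw [uIcc_of_le ht.1.le, uIcc_of_le zero_le_one]
    exact Icc_subset_Icc_right ht.2
  change 0 ≤ (∫ v in (0 : ℝ)..1, n v) * deriv D t - (∫ v in (0 : ℝ)..t, n v) * deriv D t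
  rw [← sub_mul, hsplit]
  rcases lt_or_gt_of_ne hne.1 with h2 | h2
  · exact mul_nonneg (hN₁ t ⟨ht.1, h2⟩) (deriv_nonneg_of_monotoneOn hD₁ ⟨ht.1, h2⟩)
  rcases lt_or_gt_of_ne hne.2.1 with h1 | h1
  · exact mul_nonneg_of_nonpos_of_nonpos (hN₂ t ⟨h2.le, h1.le⟩)
      (deriv_nonpos_of_antitoneOn hD₂ ⟨h2, h1⟩)
  · exact mul_nonneg (hN₃ t ⟨h1.le, ht.2⟩)
      (deriv_nonneg_of_monotoneOn hD₃ ⟨h1, lt_of_le_of_ne ht.2 hne.2.2⟩)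

/-- The primitive of a function that is antitone on `(0,a]` is concave there. -/
lemma integral_mul_le_integral_mul_of_antitoneOn {n : ℝ → ℝ} {a x y z : ℝ}
    (hn : IntervalIntegrable n volume 0 1) (hanti : AntitoneOn n (Ioc 0 a)) (ha : a ≤ 1)
    (hx : 0 ≤ x) (hxy : x < y) (hyz : y ≤ z) (hz : z ≤ a) :
    (∫ t in y..z, n t) * (y - x) ≤ (∫ t in x..y, n t) * (z - y) := by
  have hint : ∀ s t, 0 ≤ s → s ≤ t → t ≤ a → IntervalIntegrable n volume s t := by
    intro s t hs hst ht
    apply hn.mono_set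
    rw [uIcc_of_le hst, uIcc_of_le zero_le_one]
    exact Icc_subset_Icc hs (ht.trans ha)
  have hy : y ∈ Ioc 0 a := ⟨hx.trans_lt hxy, hyz.trans hz⟩
  -- Both averages are compared with the value `n y` at the common endpoint.
  have h1 : ∫ t in y..z, n t ≤ (z - y) * n y := by
    rw [← smul_eq_mul, ← intervalIntegral.integral_const]
    apply intervalIntegral.integral_mono_on hyz (hint y z hy.1.le hyz hz) intervalIntegrable_const
    intro t ht
    exact hanti hy ⟨hy.1.trans_le ht.1, ht.2.trans hz⟩ ht.1
  have h2 : (y - x) * n y ≤ ∫ t in x..y, n t := by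
    rw [← smul_eq_mul, ← intervalIntegral.integral_const]
    apply intervalIntegral.integral_mono_on_of_le_Ioo hxy.le intervalIntegrable_const
      (hint x y hx hxy.le hy.2)
    intro t ht
    exact hanti ⟨hx.trans_lt ht.1, ht.2.le.trans hy.2⟩ hy ht.2.le
  nlinarith [mul_le_mul_of_nonneg_right h1 (sub_pos.2 hxy).le,
    mul_le_mul_of_nonneg_right h2 (sub_nonneg.2 hyz)]

/-! ### Signs of the tail integrals of the margin and the variational inequality. -/

namespace RetentionSetting

variable {T Q : ℝ → ℝ} {α a z₂ z₁ : ℝ}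

/-- The marginal value of retention along the layer contract, net of the multiplier. -/
noncomputable def margin (T Q : ℝ → ℝ) (α z₂ z₁ t : ℝ) : ℝ :=
  Real.exp (α * layer (Q z₂) (Q z₁) (Q t)) * deriv T t -
    Real.exp (α * (Q z₁ - Q z₂)) * chordSlope T z₁

lemma continuousOn_exp_layer (h : RetentionSetting T Q α a) (q₂ q₁ : ℝ) :
    ContinuousOn (fun t => Real.exp (α * layer q₂ q₁ (Q t))) (Icc 0 1) :=
  (continuousOn_const.mul ((continuous_layer q₂ q₁).comp_continuousOn h.continuousOn)).rexp

lemma intervalIntegrable_margin (h : RetentionSetting T Q α a) (z₂ z₁ : ℝ) {x y : ℝ}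
    (hx : x ∈ Icc (0 : ℝ) 1) (hy : y ∈ Icc (0 : ℝ) 1) :
    IntervalIntegrable (margin T Q α z₂ z₁) volume x y :=
  (h.weighting.intervalIntegrable_mul_deriv (h.continuousOn_exp_layer _ _) hx hy).sub
    intervalIntegrable_const

lemma integral_margin_eq (h : RetentionSetting T Q α a) (z₂ z₁ : ℝ) {x y : ℝ}
    (hx : x ∈ Icc (0 : ℝ) 1) (hy : y ∈ Icc (0 : ℝ) 1) :
    ∫ t in x..y, margin T Q α z₂ z₁ t =
      (∫ t in x..y, Real.exp (α * layer (Q z₂) (Q z₁) (Q t)) * deriv T t) -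
        (y - x) * (Real.exp (α * (Q z₁ - Q z₂)) * chordSlope T z₁) := by
  unfold margin
  rw [intervalIntegral.integral_sub
    (h.weighting.intervalIntegrable_mul_deriv (h.continuousOn_exp_layer _ _) hx hy)
    intervalIntegrable_const, intervalIntegral.integral_const, smul_eq_mul]

/-- Before `a ≤ z₁` the layer is the positive part of `Q t - Q z₂`. Up to a constant the margin is
thus the maximum of `exp (α (Q - Q z₂)) T'` and `T'`, both strictly decreasing. -/
lemma strictAntiOn_margin (h : RetentionSetting T Q α a) (hz₂ : 0 ≤ z₂) (hz₂a : z₂ ≤ a)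
    (hz₁a : a ≤ z₁) (hz₁ : z₁ ≤ 1) : StrictAntiOn (margin T Q α z₂ z₁) (Ioc 0 a) := by
  have ⟨ha0, ha1⟩ := h.Ioo_turning
  have hval : ∀ t ∈ Ioc 0 a, Real.exp (α * layer (Q z₂) (Q z₁) (Q t)) * deriv T t =
      max (Real.exp (α * (Q t - Q z₂)) * deriv T t) (deriv T t) := by
    intro t ht
    have ht1 : t ∈ Icc (0 : ℝ) 1 := ⟨ht.1.le, ht.2.trans ha1.le⟩
    have hT0 := h.weighting.deriv_nonneg ⟨ht.1, ht.2.trans_lt ha1⟩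
    have hQ1 : Q t ≤ Q z₁ :=
      h.monotoneOn ht1 ⟨hz₂.trans (hz₂a.trans hz₁a), hz₁⟩ (ht.2.trans hz₁a)
    have hQ2 : Q z₂ ≤ Q z₁ := h.monotoneOn ⟨hz₂, hz₂a.trans (hz₁a.trans hz₁)⟩
      ⟨hz₂.trans (hz₂a.trans hz₁a), hz₁⟩ (hz₂a.trans hz₁a)
    rcases le_total (Q t) (Q z₂) with hq | hq
    · rw [layer_of_le hQ2 hq, mul_zero, Real.exp_zero, one_mul, max_eq_right]
      apply mul_le_of_le_one_left hT0
      rw [Real.exp_le_one_iff]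
      exact mul_nonpos_of_nonneg_of_nonpos h.pos.le (by linarith)
    · rw [layer_of_mem hq hQ1, max_eq_left]
      apply le_mul_of_one_le_left hT0
      rw [Real.one_le_exp_iff]
      exact mul_nonneg h.pos.le (by linarith)
  intro x hx y hy hxy
  simp only [margin, hval x hx, hval y hy]
  apply sub_lt_sub_right
  exact max_lt_max (h.strictAntiOn_exp_sub _ hx hy hxy) (h.strictAntiOn_deriv hx hy hxy)

/-- Conditions under which the layer between `Q z₂` and `Q z₁` is optimal. -/
structure IsStationary (T Q : ℝ → ℝ) (α a z₂ z₁ : ℝ) : Prop where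
  nonneg : 0 ≤ z₂
  lt_turning : z₂ < a
  turning_le : a ≤ z₁
  lt_one : z₁ < 1
  gap_nonneg : 0 ≤ gap T Q α z₂ z₁
  gap_eq_zero : 0 < z₂ → gap T Q α z₂ z₁ = 0

lemma quantile_le (h : RetentionSetting T Q α a) (hs : IsStationary T Q α a z₂ z₁) :
    Q z₂ ≤ Q z₁ :=
  have h21 := hs.lt_turning.le.trans hs.turning_le
  h.monotoneOn ⟨hs.nonneg, h21.trans hs.lt_one.le⟩ ⟨hs.nonneg.trans h21, hs.lt_one.le⟩ h21

/-- The layer is exhausted above `z₁`, so the integral is explicit; the multiplier is chosen to make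
it vanish at `z₁`. -/
lemma integral_margin_of_ge (h : RetentionSetting T Q α a) (hs : IsStationary T Q α a z₂ z₁)
    {z : ℝ} (hz : z ∈ Icc z₁ 1) : ∫ t in z..1, margin T Q α z₂ z₁ t =
      Real.exp (α * (Q z₁ - Q z₂)) * (1 - T z - chordSlope T z₁ * (1 - z)) := by
  have h01 : 0 ≤ z₁ := hs.nonneg.trans (hs.lt_turning.le.trans hs.turning_le)
  have hz' : z ∈ Icc (0 : ℝ) 1 := ⟨h01.trans hz.1, hz.2⟩
  rw [h.integral_margin_eq _ _ hz' ⟨zero_le_one, le_rfl⟩]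
  have : ∫ t in z..1, Real.exp (α * layer (Q z₂) (Q z₁) (Q t)) * deriv T t =
      ∫ t in z..1, Real.exp (α * (Q z₁ - Q z₂)) * deriv T t := by
    apply intervalIntegral.integral_congr
    intro t ht
    rw [uIcc_of_le hz.2] at ht
    simp only
    rw [layer_of_ge (h.quantile_le hs) (h.monotoneOn ⟨h01, hs.lt_one.le⟩
      ⟨hz'.1.trans ht.1, ht.2⟩ (hz.1.trans ht.1))]
  rw [this, intervalIntegral.integral_const_mul, h.weighting.integral_deriv hz'.1 hz.2 le_rfl,
    h.weighting.map_one]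
  ring

lemma integral_margin_le (h : RetentionSetting T Q α a) (hs : IsStationary T Q α a z₂ z₁)
    {z : ℝ} (hz : z ∈ Icc (0 : ℝ) 1) : ∫ t in z..1, margin T Q α z₂ z₁ t ≤
      Real.exp (α * (Q z₁ - Q z₂)) * (1 - T z - chordSlope T z₁ * (1 - z)) := by
  rw [h.integral_margin_eq _ _ hz ⟨zero_le_one, le_rfl⟩]
  have h1 := integral_mul_deriv_le h.weighting (h.continuousOn_exp_layer (Q z₂) (Q z₁)) hz.1 hz.2
    le_rfl (C := Real.exp (α * (Q z₁ - Q z₂))) fun t _ => Real.exp_le_exp.2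
      (mul_le_mul_of_nonneg_left (layer_le (h.quantile_le hs) _) h.pos.le)
  rw [h.weighting.map_one] at h1
  linarith

/-- The tail beyond `z₁` vanishes and on `[z₂,z₁]` the layer is `Q - Q z₂`. This identifies the gap
equation as the stationarity condition at the lower level. -/
lemma integral_margin_lower (h : RetentionSetting T Q α a) (hs : IsStationary T Q α a z₂ z₁) :
    ∫ t in z₂..1, margin T Q α z₂ z₁ t = -gap T Q α z₂ z₁ := by
  have h21 := hs.lt_turning.le.trans hs.turning_le
  have hz₂ : z₂ ∈ Icc (0 : ℝ) 1 := ⟨hs.nonneg, h21.trans hs.lt_one.le⟩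
  have hz₁ : z₁ ∈ Icc (0 : ℝ) 1 := ⟨hs.nonneg.trans h21, hs.lt_one.le⟩
  have h1 : (1 : ℝ) ∈ Icc (0 : ℝ) 1 := ⟨zero_le_one, le_rfl⟩
  rw [← intervalIntegral.integral_add_adjacent_intervals
    (h.intervalIntegrable_margin z₂ z₁ hz₂ hz₁) (h.intervalIntegrable_margin z₂ z₁ hz₁ h1),
    h.integral_margin_of_ge hs ⟨le_rfl, hs.lt_one.le⟩,
    InverseSShaped.chordSlope_mul T hs.lt_one, sub_self, mul_zero, add_zero, gap,
    ← intervalIntegral.integral_neg]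
  apply intervalIntegral.integral_congr
  intro t ht
  rw [uIcc_of_le h21] at ht
  have ht' : t ∈ Icc (0 : ℝ) 1 := ⟨hz₂.1.trans ht.1, ht.2.trans hz₁.2⟩
  simp only [margin]
  rw [layer_of_mem (h.monotoneOn hz₂ ht' ht.1) (h.monotoneOn ht' hz₁ ht.2)]
  ring

lemma integral_margin_nonneg_of_ge (h : RetentionSetting T Q α a)
    (hs : IsStationary T Q α a z₂ z₁) {z : ℝ} (hz : z ∈ Icc z₁ 1) :
    0 ≤ ∫ t in z..1, margin T Q α z₂ z₁ t := by
  rw [h.integral_margin_of_ge hs hz]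
  apply mul_nonneg (Real.exp_pos _).le
  rcases hz.2.lt_or_eq with hlt | rfl
  · rw [← InverseSShaped.chordSlope_mul T hlt, ← sub_mul]
    apply mul_nonneg _ (by linarith)
    rw [sub_nonneg]
    exact h.turning.2.2.monotoneOn ⟨hs.turning_le, hs.lt_one⟩ ⟨hs.turning_le.trans hz.1, hlt⟩ hz.1
  · simp [h.weighting.map_one]

lemma integral_margin_nonpos_of_turning_le (h : RetentionSetting T Q α a)
    (hs : IsStationary T Q α a z₂ z₁) {z : ℝ} (hz : z ∈ Icc a z₁) :
    ∫ t in z..1, margin T Q α z₂ z₁ t ≤ 0 := by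
  have hz1 := hz.2.trans_lt hs.lt_one
  refine (h.integral_margin_le hs ⟨h.Ioo_turning.1.le.trans hz.1, hz1.le⟩).trans ?_
  apply mul_nonpos_of_nonneg_of_nonpos (Real.exp_pos _).le
  rw [← InverseSShaped.chordSlope_mul T hz1, ← sub_mul]
  apply mul_nonpos_of_nonpos_of_nonneg _ (by linarith)
  rw [sub_nonpos]
  exact h.turning.2.2.monotoneOn ⟨hz.1, hz1⟩ ⟨hs.turning_le, hs.lt_one⟩ hz.2

lemma integral_margin_split (h : RetentionSetting T Q α a) (z₂ z₁ : ℝ) {x y : ℝ}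
    (hx : x ∈ Icc (0 : ℝ) 1) (hy : y ∈ Icc (0 : ℝ) 1) :
    ∫ t in x..1, margin T Q α z₂ z₁ t =
      (∫ t in x..y, margin T Q α z₂ z₁ t) + ∫ t in y..1, margin T Q α z₂ z₁ t :=
  (intervalIntegral.integral_add_adjacent_intervals (h.intervalIntegrable_margin z₂ z₁ hx hy)
    (h.intervalIntegrable_margin z₂ z₁ hy ⟨zero_le_one, le_rfl⟩)).symm

/-- The tail integral is convex on `(0,a]`, vanishes at `z₂` and is nonpositive at `a > z₂`, so it
is nonnegative to the left of `z₂`. -/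
lemma integral_margin_nonneg_of_le (h : RetentionSetting T Q α a)
    (hs : IsStationary T Q α a z₂ z₁) {z : ℝ} (hz : z ∈ Ioo 0 z₂) :
    0 ≤ ∫ t in z..1, margin T Q α z₂ z₁ t := by
  have ⟨ha0, ha1⟩ := h.Ioo_turning
  have hN2 := h.integral_margin_lower hs
  rw [hs.gap_eq_zero (hz.1.trans hz.2), neg_zero] at hN2
  have hz2 : z₂ ∈ Icc (0 : ℝ) 1 := ⟨hs.nonneg, (hs.lt_turning.trans ha1).le⟩
  have hNa := h.integral_margin_nonpos_of_turning_le hs ⟨le_rfl, hs.turning_le⟩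
  have e1 := h.integral_margin_split z₂ z₁ ⟨hz.1.le, hz.2.le.trans hz2.2⟩ hz2
  have e2 := h.integral_margin_split z₂ z₁ hz2 ⟨ha0.le, ha1.le⟩
  have hconv := integral_mul_le_integral_mul_of_antitoneOn
    (h.intervalIntegrable_margin z₂ z₁ ⟨le_rfl, zero_le_one⟩ ⟨zero_le_one, le_rfl⟩)
    (h.strictAntiOn_margin hs.nonneg hs.lt_turning.le hs.turning_le hs.lt_one.le).antitoneOn
    ha1.le hz.1.le hz.2 hs.lt_turning.le le_rfl
  have hA : 0 ≤ ∫ t in z₂..a, margin T Q α z₂ z₁ t := by linarith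
  have hB : 0 ≤ (∫ t in z..z₂, margin T Q α z₂ z₁ t) * (a - z₂) :=
    le_trans (mul_nonneg hA (sub_nonneg.2 hz.2.le)) hconv
  have := nonneg_of_mul_nonneg_left hB (sub_pos.2 hs.lt_turning)
  linarith

/-- A convex function that is nonpositive at `z₂` and at `a` is nonpositive in between; beyond `a`,
monotonicity of the chord slope takes over. -/
lemma integral_margin_nonpos (h : RetentionSetting T Q α a)
    (hs : IsStationary T Q α a z₂ z₁) {z : ℝ} (hz : z ∈ Icc z₂ z₁) :
    ∫ t in z..1, margin T Q α z₂ z₁ t ≤ 0 := by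
  have ⟨ha0, ha1⟩ := h.Ioo_turning
  rcases le_total a z with hza | hza
  · exact h.integral_margin_nonpos_of_turning_le hs ⟨hza, hz.2⟩
  have hN2 := h.integral_margin_lower hs
  have hN2' : ∫ t in z₂..1, margin T Q α z₂ z₁ t ≤ 0 := by linarith [hs.gap_nonneg]
  rcases hz.1.lt_or_eq with hlt | heq
  swap
  · rwa [← heq]
  have hz2 : z₂ ∈ Icc (0 : ℝ) 1 := ⟨hs.nonneg, (hs.lt_turning.trans ha1).le⟩
  have hz' : z ∈ Icc (0 : ℝ) 1 := ⟨hs.nonneg.trans hz.1, hza.trans ha1.le⟩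
  have hNa := h.integral_margin_nonpos_of_turning_le hs ⟨le_rfl, hs.turning_le⟩
  have e1 := h.integral_margin_split z₂ z₁ hz2 hz'
  have e2 := h.integral_margin_split z₂ z₁ hz' ⟨ha0.le, ha1.le⟩
  have hconv := integral_mul_le_integral_mul_of_antitoneOn
    (h.intervalIntegrable_margin z₂ z₁ ⟨le_rfl, zero_le_one⟩ ⟨zero_le_one, le_rfl⟩)
    (h.strictAntiOn_margin hs.nonneg hs.lt_turning.le hs.turning_le hs.lt_one.le).antitoneOn
    ha1.le hs.nonneg hlt hza le_rfl
  by_contra! hpos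
  have hA : 0 < ∫ t in z..a, margin T Q α z₂ z₁ t := by linarith
  have hB : ∫ t in z₂..z, margin T Q α z₂ z₁ t < 0 := by linarith
  have h1 := mul_pos hA (sub_pos.2 hlt)
  have h2 := mul_nonpos_of_nonpos_of_nonneg hB.le (sub_nonneg.2 hza)
  linarith

/-- The variational inequality at a stationary layer. -/
lemma integral_margin_mul_nonneg (h : RetentionSetting T Q α a)
    (hs : IsStationary T Q α a z₂ z₁) {G : ℝ → ℝ} (hG0 : G 0 = 0)
    (hG : ∀ s ∈ Icc (0 : ℝ) 1, ∀ t ∈ Icc (0 : ℝ) 1, s ≤ t → 0 ≤ G t - G s ∧ G t - G s ≤ Q t - Q s) :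
    0 ≤ ∫ t in (0 : ℝ)..1, margin T Q α z₂ z₁ t * (G t - layer (Q z₂) (Q z₁) (Q t)) := by
  have ⟨ha0, ha1⟩ := h.Ioo_turning
  have h21 := hs.lt_turning.le.trans hs.turning_le
  have hq := h.quantile_le hs
  have hm0 : (0 : ℝ) ∈ Icc (0 : ℝ) 1 := ⟨le_rfl, zero_le_one⟩
  have hz₂ : z₂ ∈ Icc (0 : ℝ) 1 := ⟨hs.nonneg, h21.trans hs.lt_one.le⟩
  have hz₁ : z₁ ∈ Icc (0 : ℝ) 1 := ⟨hs.nonneg.trans h21, hs.lt_one.le⟩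
  have hinc : ∀ s ∈ Icc (0 : ℝ) 1, ∀ t ∈ Icc (0 : ℝ) 1, s ≤ t →
      |(G s - layer (Q z₂) (Q z₁) (Q s)) - (G t - layer (Q z₂) (Q z₁) (Q t))| ≤ Q t - Q s := by
    intro s hs' t ht hst
    have h1 := hG s hs' t ht hst
    have h2 := layer_sub_mem hq (h.monotoneOn hs' ht hst)
    rw [abs_le]
    constructor <;> linarith [h1.1, h1.2, h2.1, h2.2]
  -- The difference `G - layer` increases where the layer is flat and decreases where the layer
  -- grows at the maximal rate, that of `Q`.
  apply integral_mul_nonneg_of_piecewise_monotone (z₂ := z₂) (z₁ := z₁)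
    (h.intervalIntegrable_margin z₂ z₁ hm0 ⟨zero_le_one, le_rfl⟩)
  · apply absolutelyContinuousOnInterval_of_dist_le h.absCont
    rw [uIcc_of_le zero_le_one]
    intro s hs' t ht
    rw [Real.dist_eq, Real.dist_eq]
    rcases le_total s t with hst | hst
    · rw [abs_sub_comm (Q s)]
      exact (hinc s hs' t ht hst).trans (le_abs_self _)
    · rw [abs_sub_comm]
      exact (hinc t ht s hs' hst).trans (le_abs_self _)
  · rw [hG0, layer_of_le hq (h.monotoneOn hm0 hz₂ hs.nonneg), sub_zero]
  · intro s hs' t ht hst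
    have hs1 : s ∈ Icc (0 : ℝ) 1 := ⟨hs'.1, hs'.2.trans hz₂.2⟩
    have ht1 : t ∈ Icc (0 : ℝ) 1 := ⟨ht.1, ht.2.trans hz₂.2⟩
    simp only
    rw [layer_of_le hq (h.monotoneOn hs1 hz₂ hs'.2), layer_of_le hq (h.monotoneOn ht1 hz₂ ht.2)]
    linarith [(hG s hs1 t ht1 hst).1]
  · exact fun z hz => h.integral_margin_nonneg_of_le hs hz
  · intro s hs' t ht hst
    have hs1 : s ∈ Icc (0 : ℝ) 1 := ⟨hz₂.1.trans hs'.1, hs'.2.trans hz₁.2⟩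
    have ht1 : t ∈ Icc (0 : ℝ) 1 := ⟨hz₂.1.trans ht.1, ht.2.trans hz₁.2⟩
    simp only
    rw [layer_of_mem (h.monotoneOn hz₂ hs1 hs'.1) (h.monotoneOn hs1 hz₁ hs'.2),
      layer_of_mem (h.monotoneOn hz₂ ht1 ht.1) (h.monotoneOn ht1 hz₁ ht.2)]
    linarith [(hG s hs1 t ht1 hst).2]
  · exact fun z hz => h.integral_margin_nonpos hs hz
  · intro s hs' t ht hst
    have hs1 : s ∈ Icc (0 : ℝ) 1 := ⟨hz₁.1.trans hs'.1, hs'.2⟩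
    have ht1 : t ∈ Icc (0 : ℝ) 1 := ⟨hz₁.1.trans ht.1, ht.2⟩
    simp only
    rw [layer_of_ge hq (h.monotoneOn hz₁ hs1 hs'.1), layer_of_ge hq (h.monotoneOn hz₁ ht1 ht.1)]
    linarith [(hG s hs1 t ht1 hst).1]
  · exact fun z hz => h.integral_margin_nonneg_of_ge hs hz

end RetentionSetting

/-! ### Convexity of the exponential objective -/

lemma exp_mul_tangent_nonneg (α x y : ℝ) :
    0 ≤ Real.exp (α * y) - Real.exp (α * x) - α * (Real.exp (α * x) * (y - x)) := by
  have h : Real.exp (α * y) = Real.exp (α * x) * Real.exp (α * (y - x)) := by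
    rw [← Real.exp_add]
    ring_nf
  rw [h]
  nlinarith [Real.add_one_le_exp (α * (y - x)), Real.exp_pos (α * x)]

lemma eq_of_exp_mul_tangent_eq_zero {α x y : ℝ} (hα : 0 < α)
    (h0 : Real.exp (α * y) - Real.exp (α * x) - α * (Real.exp (α * x) * (y - x)) = 0) :
    y = x := by
  have h : Real.exp (α * y) = Real.exp (α * x) * Real.exp (α * (y - x)) := by
    rw [← Real.exp_add]
    ring_nf
  by_contra hne
  have h1 := Real.add_one_lt_exp (mul_ne_zero hα.ne' (sub_ne_zero.2 hne))
  rw [h] at h0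
  nlinarith [Real.exp_pos (α * x)]

/-- A sufficient first-order condition for minimising `∫ exp (α G) T'` under a lower bound on
`∫ G`; the minimiser is unique. -/
lemma InverseSShaped.eqOn_of_integral_exp_le {T : ℝ → ℝ} (hT : InverseSShaped T) {α r : ℝ}
    (hα : 0 < α) (hr : 0 ≤ r) {G G' : ℝ → ℝ} (hG : ContinuousOn G (Icc 0 1))
    (hG' : ContinuousOn G' (Icc 0 1)) (hint : ∫ t in (0 : ℝ)..1, G' t ≤ ∫ t in (0 : ℝ)..1, G t)
    (hfoc : 0 ≤ ∫ t in (0 : ℝ)..1, (Real.exp (α * G' t) * deriv T t - r) * (G t - G' t)) :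
    ∫ t in (0 : ℝ)..1, Real.exp (α * G' t) * deriv T t ≤
      ∫ t in (0 : ℝ)..1, Real.exp (α * G t) * deriv T t ∧
    (∫ t in (0 : ℝ)..1, Real.exp (α * G t) * deriv T t ≤
      ∫ t in (0 : ℝ)..1, Real.exp (α * G' t) * deriv T t → EqOn G G' (Icc 0 1)) := by
  have h0 : (0 : ℝ) ∈ Icc (0 : ℝ) 1 := ⟨le_rfl, zero_le_one⟩
  have h1 : (1 : ℝ) ∈ Icc (0 : ℝ) 1 := ⟨zero_le_one, le_rfl⟩
  have cE : ContinuousOn (fun t => Real.exp (α * G t)) (Icc 0 1) :=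
    (continuousOn_const.mul hG).rexp
  have cE' : ContinuousOn (fun t => Real.exp (α * G' t)) (Icc 0 1) :=
    (continuousOn_const.mul hG').rexp
  have cD : ContinuousOn (fun t => G t - G' t) (Icc 0 1) := hG.sub hG'
  have iE := hT.intervalIntegrable_mul_deriv cE h0 h1
  have iE' := hT.intervalIntegrable_mul_deriv cE' h0 h1
  have iM : IntervalIntegrable (fun t => Real.exp (α * G' t) * (G t - G' t) * deriv T t)
      volume 0 1 := hT.intervalIntegrable_mul_deriv (cE'.mul cD) h0 h1
  have iD : IntervalIntegrable (fun t => G t - G' t) volume 0 1 :=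
    cD.intervalIntegrable_of_Icc zero_le_one
  have hfoc' : ∫ t in (0 : ℝ)..1, (Real.exp (α * G' t) * deriv T t - r) * (G t - G' t) =
      (∫ t in (0 : ℝ)..1, Real.exp (α * G' t) * (G t - G' t) * deriv T t) -
        r * ∫ t in (0 : ℝ)..1, (G t - G' t) := by
    rw [← intervalIntegral.integral_const_mul, ← intervalIntegral.integral_sub iM (iD.const_mul r)]
    apply intervalIntegral.integral_congr
    intro t _
    simp only
    ring
  have hDnonneg : 0 ≤ ∫ t in (0 : ℝ)..1, (G t - G' t) := by
    rw [intervalIntegral.integral_sub (hG.intervalIntegrable_of_Icc zero_le_one)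
      (hG'.intervalIntegrable_of_Icc zero_le_one)]
    linarith
  have hM : 0 ≤ ∫ t in (0 : ℝ)..1, Real.exp (α * G' t) * (G t - G' t) * deriv T t := by
    linarith [mul_nonneg hr hDnonneg]
  -- The weighted remainder of the exponential over its tangent at `G'`: nonnegative almost
  -- everywhere, and zero only where `G = G'`.
  set R : ℝ → ℝ := fun t => (Real.exp (α * G t) - Real.exp (α * G' t) -
    α * (Real.exp (α * G' t) * (G t - G' t))) * deriv T t with hR
  have iR : IntervalIntegrable R volume 0 1 :=
    hT.intervalIntegrable_mul_deriv ((cE.sub cE').sub (continuousOn_const.mul (cE'.mul cD))) h0 h1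
  have hRint : ∫ t in (0 : ℝ)..1, R t = (∫ t in (0 : ℝ)..1, Real.exp (α * G t) * deriv T t) -
      (∫ t in (0 : ℝ)..1, Real.exp (α * G' t) * deriv T t) -
      α * ∫ t in (0 : ℝ)..1, Real.exp (α * G' t) * (G t - G' t) * deriv T t := by
    rw [← intervalIntegral.integral_const_mul, ← intervalIntegral.integral_sub iE iE',
      ← intervalIntegral.integral_sub (iE.sub iE') (iM.const_mul α)]
    apply intervalIntegral.integral_congr
    intro t _
    simp only [hR]
    ring
  have hRae : 0 ≤ᵐ[volume.restrict (Ioc 0 1)] R := by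
    filter_upwards [ae_restrict_mem measurableSet_Ioc, ae_restrict_of_ae hT.ae_deriv_pos]
      with t ht hpos
    exact mul_nonneg (exp_mul_tangent_nonneg _ _ _) (hpos ht).le
  have hRnonneg : 0 ≤ ∫ t in (0 : ℝ)..1, R t :=
    intervalIntegral.integral_nonneg_of_ae_restrict zero_le_one
      (by rwa [Measure.restrict_congr_set Ioc_ae_eq_Icc.symm])
  have hαM := mul_nonneg hα.le hM
  refine ⟨by linarith, fun hle => ?_⟩
  have hR0 : ∫ t in (0 : ℝ)..1, R t = 0 := by linarith
  rw [intervalIntegral.integral_eq_zero_iff_of_le_of_nonneg_ae zero_le_one hRae iR] at hR0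
  apply Measure.eqOn_Icc_of_ae_eq volume zero_ne_one _ hG hG'
  rw [Measure.restrict_congr_set Ioc_ae_eq_Icc.symm]
  filter_upwards [hR0, ae_restrict_mem measurableSet_Ioc, ae_restrict_of_ae hT.ae_deriv_pos]
    with t ht htI hpos
  have ht' : R t = 0 := ht
  exact eq_of_exp_mul_tangent_eq_zero hα ((mul_eq_zero.1 ht').resolve_right (hpos htI).ne')

/-! ### Verification of optimality -/

lemma IsIndemnity.continuousOn {M : ℝ} {I : ℝ → ℝ} (hI : IsIndemnity M I) :
    ContinuousOn I (Icc 0 M) := by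
  have : LipschitzOnWith 1 I (Icc 0 M) := by
    apply LipschitzOnWith.of_dist_le_mul
    intro x hx y hy
    rw [Real.dist_eq, Real.dist_eq, NNReal.coe_one, one_mul]
    rcases le_total y x with h | h
    · have := hI.2 x y hy.1 h hx.2
      rw [abs_of_nonneg this.1, abs_of_nonneg (by linarith)]
      exact this.2
    · have := hI.2 y x hx.1 h hy.2
      rw [abs_sub_comm, abs_sub_comm x, abs_of_nonneg this.1, abs_of_nonneg (by linarith)]
      exact this.2
  exact this.continuousOn

lemma IsIndemnity.mem_Icc {M : ℝ} {I : ℝ → ℝ} (hI : IsIndemnity M I) {x : ℝ}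
    (hx : x ∈ Icc 0 M) : 0 ≤ I x ∧ I x ≤ x := by
  have := hI.2 x 0 le_rfl hx.1 hx.2
  rw [hI.1] at this
  constructor <;> linarith [this.1, this.2]

lemma IsIndemnity.congr {M : ℝ} (hM : 0 < M) {I J : ℝ → ℝ} (hJ : IsIndemnity M J)
    (h : EqOn I J (Icc 0 M)) : IsIndemnity M I := by
  refine ⟨(h ⟨le_rfl, hM.le⟩).trans hJ.1, fun x y hy hyx hx => ?_⟩
  rw [h ⟨hy.trans hyx, hx⟩, h ⟨hy, hyx.trans hx⟩]
  exact hJ.2 x y hy hyx hx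

section Verification

variable {Ω : Type*} [MeasurableSpace Ω] {P : Measure Ω} {X : Ω → ℝ} {T u : ℝ → ℝ} {M : ℝ}

lemma LossAssumption.ae_eq_of_eqOn (hX : LossAssumption P X M) {I J : ℝ → ℝ}
    (h : EqOn I J (Icc 0 M)) : (fun ω => I (X ω)) =ᵐ[P] fun ω => J (X ω) := by
  filter_upwards [hX.support] with ω hω using h hω

/-- The retained loss in quantile form. -/
noncomputable def retention (P : Measure Ω) (X : Ω → ℝ) (I : ℝ → ℝ) (t : ℝ) : ℝ :=
  quantile P X t - I (quantile P X t)

variable [IsProbabilityMeasure P]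

lemma LossAssumption.continuousOn_retention (hX : LossAssumption P X M) (hM : 0 < M) {I : ℝ → ℝ}
    (hI : IsIndemnity M I) : ContinuousOn (retention P X I) (Icc 0 1) :=
  hX.continuousOn_quantile.sub
    (hI.continuousOn.comp hX.continuousOn_quantile fun _ ht => hX.quantile_mem hM ht)

lemma LossAssumption.retention_zero (hX : LossAssumption P X M) (hM : 0 < M) {I : ℝ → ℝ}
    (hI : IsIndemnity M I) : retention P X I 0 = 0 := by
  rw [retention, hX.quantile_zero hM, hI.1, sub_zero]

lemma LossAssumption.retention_sub_mem (hX : LossAssumption P X M) (hM : 0 < M) {I : ℝ → ℝ}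
    (hI : IsIndemnity M I) {s t : ℝ} (hs : s ∈ Icc (0 : ℝ) 1) (ht : t ∈ Icc (0 : ℝ) 1)
    (hst : s ≤ t) : 0 ≤ retention P X I t - retention P X I s ∧
      retention P X I t - retention P X I s ≤ quantile P X t - quantile P X s := by
  have := hI.2 _ _ (quantile_nonneg P X s) (hX.monotoneOn_quantile hM hs ht hst)
    (hX.quantile_mem hM ht).2
  unfold retention
  constructor <;> linarith [this.1, this.2]

lemma LossAssumption.integral_indemnity (hX : LossAssumption P X M) (hM : 0 < M) {I : ℝ → ℝ}
    (hI : IsIndemnity M I) :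
    ∫ ω, I (X ω) ∂P = (∫ ω, X ω ∂P) - ∫ t in (0 : ℝ)..1, retention P X I t := by
  rw [hX.integral_comp_eq hM hI.continuousOn, hX.integral_comp_eq hM (φ := fun x => x)
    continuousOn_id, ← intervalIntegral.integral_sub
      (hX.continuousOn_quantile.intervalIntegrable_of_Icc zero_le_one)
      ((hX.continuousOn_retention hM hI).intervalIntegrable_of_Icc zero_le_one)]
  apply intervalIntegral.integral_congr
  intro t _
  simp [retention]

/-- The exponential separates wealth from retained loss, and `T'` has total mass one, so maximising
utility means minimising a functional free of the premium. -/
lemma LossAssumption.rdu_indemnity (hX : LossAssumption P X M) (hM : 0 < M)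
    (hT : InverseSShaped T) {α A B w : ℝ}
    (hu : ∀ x, 0 ≤ x → u x = B - A * Real.exp (-α * x)) (hw : M ≤ w) {I : ℝ → ℝ}
    (hI : IsIndemnity M I) :
    rdu hT u P (fun ω => w - X ω + I (X ω)) = B - A * Real.exp (-α * w) *
      ∫ t in (0 : ℝ)..1, Real.exp (α * retention P X I t) * deriv T t := by
  rw [hX.rdu_eq hM hT (φ := fun x => w - x + I x) (v := fun x => B - A * Real.exp (-α * x))
    ((continuousOn_const.sub continuousOn_id).add hI.continuousOn) _ _ (by fun_prop)
    fun x hx => hu x hx]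
  · have h0 : (0 : ℝ) ∈ Icc (0 : ℝ) 1 := ⟨le_rfl, zero_le_one⟩
    have h1 : (1 : ℝ) ∈ Icc (0 : ℝ) 1 := ⟨zero_le_one, le_rfl⟩
    have hone := hT.integral_deriv le_rfl zero_le_one le_rfl
    rw [hT.map_one, hT.map_zero, sub_zero] at hone
    have hB : B = ∫ t in (0 : ℝ)..1, B * deriv T t := by
      rw [intervalIntegral.integral_const_mul, hone, mul_one]
    have iE : IntervalIntegrable (fun t => Real.exp (α * retention P X I t) * deriv T t)
        volume 0 1 := hT.intervalIntegrable_mul_deriv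
      ((continuousOn_const.mul (hX.continuousOn_retention hM hI)).rexp) h0 h1
    conv_rhs => rw [hB]
    rw [← intervalIntegral.integral_const_mul, ← intervalIntegral.integral_sub
      (hT.intervalIntegrable_mul_deriv continuousOn_const h0 h1) (iE.const_mul _)]
    apply intervalIntegral.integral_congr
    intro t _
    have he : Real.exp (-α * (w - quantile P X t + I (quantile P X t))) =
        Real.exp (-α * w) * Real.exp (α * retention P X I t) := by
      rw [← Real.exp_add, retention]
      ring_nf
    simp only [he]
    ring
  · intro x hx y hy hxy
    have := (hI.2 y x hx.1 hxy hy.2).2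
    simp only
    linarith
  · intro x hx
    have := (hI.mem_Icc hx).1
    linarith [hx.2]

/-- An indemnity that exhausts the budget and satisfies the variational inequality is the unique
optimal one. -/
lemma LossAssumption.isOptimal_iff (hX : LossAssumption P X M) (hM : 0 < M)
    (hT : InverseSShaped T) {α A B ρ W₀ π r : ℝ} (hα : 0 < α) (hA : 0 < A) (hρ : -1 < ρ)
    (hu : ∀ x, 0 ≤ x → u x = B - A * Real.exp (-α * x)) (hw : M ≤ W₀ - π) (hr : 0 ≤ r)
    {J : ℝ → ℝ} (hJ : IsIndemnity M J) (hbudget : ∫ ω, J (X ω) ∂P = π / (1 + ρ))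
    (hfoc : ∀ I, IsFeasible P X M ρ π I → 0 ≤ ∫ t in (0 : ℝ)..1,
      (Real.exp (α * retention P X J t) * deriv T t - r) *
        (retention P X I t - retention P X J t)) (I : ℝ → ℝ) :
    IsOptimal hT u P X M ρ W₀ π I ↔ EqOn I J (Icc 0 M) := by
  have hρ' : 0 < 1 + ρ := by linarith
  have hJf : IsFeasible P X M ρ π J :=
    ⟨hJ, by rw [hbudget, mul_div_cancel₀ _ hρ'.ne']⟩
  have hmin : ∀ K, IsFeasible P X M ρ π K → _ := fun K hK =>
    hT.eqOn_of_integral_exp_le hα hr (hX.continuousOn_retention hM hK.1)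
      (hX.continuousOn_retention hM hJ) (by
        have h1 := hK.2
        rw [← le_div_iff₀' hρ', ← hbudget, hX.integral_indemnity hM hK.1,
          hX.integral_indemnity hM hJ] at h1
        linarith) (hfoc K hK)
  have hk : 0 < A * Real.exp (-α * (W₀ - π)) := mul_pos hA (Real.exp_pos _)
  constructor
  · rintro ⟨hI, hopt⟩
    have h1 := hopt J hJf
    rw [hX.rdu_indemnity hM hT hu hw hI.1, hX.rdu_indemnity hM hT hu hw hJ] at h1
    have h2 := (hmin I hI).2 (le_of_mul_le_mul_left (by linarith) hk)
    intro x hx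
    obtain ⟨t, ht, rfl⟩ := hX.exists_quantile_eq hM hx
    have h3 := h2 ht
    simp only [retention] at h3
    linarith
  · intro heq
    have hI : IsIndemnity M I := hJ.congr hM heq
    have hae := hX.ae_eq_of_eqOn heq
    refine ⟨⟨hI, ?_⟩, fun K hK => ?_⟩
    · rw [integral_congr_ae hae]
      exact hJf.2
    · rw [hX.rdu_indemnity hM hT hu hw hI, hX.rdu_indemnity hM hT hu hw hK.1]
      have h1 := (hmin K hK).1
      have h2 : ∫ t in (0 : ℝ)..1, Real.exp (α * retention P X I t) * deriv T t =
          ∫ t in (0 : ℝ)..1, Real.exp (α * retention P X J t) * deriv T t := by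
        apply intervalIntegral.integral_congr
        intro t ht
        rw [uIcc_of_le zero_le_one] at ht
        simp only [retention]
        rw [heq (hX.quantile_mem hM ht)]
      rw [h2]
      linarith [mul_le_mul_of_nonneg_left h1 hk.le]

lemma isIndemnity_of_layer (hM : 0 < M) {q₂ q₁ : ℝ} (h₂ : 0 ≤ q₂) (h₁ : q₂ ≤ q₁) {J : ℝ → ℝ}
    (hJ : EqOn J (fun x => x - layer q₂ q₁ x) (Icc 0 M)) : IsIndemnity M J := by
  refine IsIndemnity.congr hM ⟨?_, ?_⟩ hJ
  · rw [layer_of_le h₁ h₂, sub_zero]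
  · intro x y _ hyx _
    have := layer_sub_mem h₁ hyx
    constructor <;> linarith [this.1, this.2]

/-- A stationary layer that exhausts the budget gives the unique optimal contract. -/
lemma LossAssumption.isOptimal_iff_of_isStationary (hX : LossAssumption P X M) (hM : 0 < M)
    (hT : InverseSShaped T) {α A B ρ W₀ π a z₂ z₁ : ℝ} (hA : 0 < A) (hρ : -1 < ρ)
    (hu : ∀ x, 0 ≤ x → u x = B - A * Real.exp (-α * x)) (hw : M ≤ W₀ - π)
    (h : RetentionSetting T (quantile P X) α a)
    (hs : RetentionSetting.IsStationary T (quantile P X) α a z₂ z₁) {J : ℝ → ℝ}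
    (hJ : EqOn J (fun x => x - layer (quantile P X z₂) (quantile P X z₁) x) (Icc 0 M))
    (hbudget : ∫ ω, J (X ω) ∂P = π / (1 + ρ)) (I : ℝ → ℝ) :
    IsOptimal hT u P X M ρ W₀ π I ↔ EqOn I J (Icc 0 M) := by
  have hret : ∀ t ∈ Icc (0 : ℝ) 1, retention P X J t =
      layer (quantile P X z₂) (quantile P X z₁) (quantile P X t) := by
    intro t ht
    rw [retention, hJ (hX.quantile_mem hM ht)]
    simp
  have hr : 0 ≤ Real.exp (α * (quantile P X z₁ - quantile P X z₂)) * chordSlope T z₁ :=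
    mul_nonneg (Real.exp_pos _).le (hT.chordSlope_pos
      ⟨h.Ioo_turning.1.le.trans hs.turning_le, hs.lt_one⟩).le
  apply hX.isOptimal_iff hM hT h.pos hA hρ hu hw hr
    (isIndemnity_of_layer hM (quantile_nonneg _ _ _) (h.quantile_le hs) hJ) hbudget
  intro K hK
  refine le_of_le_of_eq (h.integral_margin_mul_nonneg hs (hX.retention_zero hM hK.1)
    fun s hs' t ht hst => hX.retention_sub_mem hM hK.1 hs' ht hst) ?_
  apply intervalIntegral.integral_congr
  intro t ht
  rw [uIcc_of_le zero_le_one] at ht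
  simp only [RetentionSetting.margin]
  rw [hret t ht]

/-- Full insurance is the unique optimal contract if the premium suffices for it. -/
lemma LossAssumption.isOptimal_iff_full (hX : LossAssumption P X M) (hM : 0 < M)
    (hT : InverseSShaped T) {α A B ρ W₀ π : ℝ} (hα : 0 < α) (hA : 0 < A) (hρ : -1 < ρ)
    (hu : ∀ x, 0 ≤ x → u x = B - A * Real.exp (-α * x)) (hw : M ≤ W₀ - π)
    (hπ : π = (1 + ρ) * ∫ ω, X ω ∂P) (I : ℝ → ℝ) :
    IsOptimal hT u P X M ρ W₀ π I ↔ EqOn I (fun z => z) (Icc 0 M) := by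
  have hJ : IsIndemnity M fun z => z := ⟨rfl, fun x y _ h _ => ⟨by linarith, le_rfl⟩⟩
  -- With nothing retained the multiplier may be zero, and the condition is that `T'` integrates
  -- nonnegative retentions to a nonnegative number.
  apply hX.isOptimal_iff hM hT hα hA hρ hu hw le_rfl hJ
  · rw [hπ, mul_div_cancel_left₀ _ (by linarith)]
  · intro K hK
    rw [intervalIntegral.integral_of_le zero_le_one]
    apply setIntegral_nonneg_of_ae_restrict
    filter_upwards [ae_restrict_mem measurableSet_Ioc, ae_restrict_of_ae hT.ae_deriv_pos]
      with t ht hpos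
    have := (hK.1.mem_Icc (hX.quantile_mem hM (Ioc_subset_Icc_self ht))).2
    simp only [retention, sub_self, sub_zero, mul_zero, Real.exp_zero, one_mul]
    exact mul_nonneg (hpos ht).le (by linarith)

/-- No insurance is the unique optimal contract if the premium is zero. -/
lemma LossAssumption.isOptimal_iff_none (hX : LossAssumption P X M) (hM : 0 < M)
    (hT : InverseSShaped T) {α A B ρ W₀ π : ℝ} (hα : 0 < α) (hA : 0 < A) (hρ : -1 < ρ)
    (hu : ∀ x, 0 ≤ x → u x = B - A * Real.exp (-α * x)) (hw : M ≤ W₀ - π)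
    {J : ℝ → ℝ} (hJ0 : EqOn J (fun _ => 0) (Icc 0 M))
    (hbudget : ∫ ω, J (X ω) ∂P = π / (1 + ρ)) (I : ℝ → ℝ) :
    IsOptimal hT u P X M ρ W₀ π I ↔ EqOn I J (Icc 0 M) := by
  have hJ : IsIndemnity M J :=
    IsIndemnity.congr hM ⟨rfl, fun x y _ h _ => ⟨by simp, by simpa using h⟩⟩ hJ0
  apply hX.isOptimal_iff hM hT hα hA hρ hu hw le_rfl hJ hbudget
  intro K hK
  have hρ' : 0 < 1 + ρ := by linarith
  have h1 := hK.2
  rw [← le_div_iff₀' hρ', ← hbudget, hX.integral_indemnity hM hK.1,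
    hX.integral_indemnity hM hJ] at h1
  have hle : ∀ t ∈ Icc (0 : ℝ) 1, retention P X K t ≤ retention P X J t := by
    intro t ht
    have h2 := (hK.1.mem_Icc (hX.quantile_mem hM ht)).1
    simp only [retention, hJ0 (hX.quantile_mem hM ht)]
    linarith
  -- No contract retains more than the whole loss, yet the budget requires at least its mean;
  -- continuity forces equality, so the feasible set is a single contract.
  have heq : ∀ t ∈ Icc (0 : ℝ) 1, retention P X K t = retention P X J t := by
    intro t ht
    by_contra hne
    have := intervalIntegral.integral_lt_integral_of_continuousOn_of_le_of_exists_lt zero_lt_one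
      (hX.continuousOn_retention hM hK.1) (hX.continuousOn_retention hM hJ)
      (fun x hx => hle x (Ioc_subset_Icc_self hx)) ⟨t, ht, lt_of_le_of_ne (hle t ht) hne⟩
    linarith
  apply le_of_eq
  symm
  rw [intervalIntegral.integral_congr (g := fun _ => 0), intervalIntegral.integral_zero]
  intro t ht
  rw [uIcc_of_le zero_le_one] at ht
  simp [heq t ht]

end Verification

/-! ### Budget equations and uniqueness of the thresholds -/

/-- The mean of the part of the loss that exceeds `q`. -/
noncomputable def stopLoss (Q : ℝ → ℝ) (q : ℝ) : ℝ := ∫ t in (0 : ℝ)..1, max (Q t - q) 0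

section StopLoss

variable {Q : ℝ → ℝ}

lemma continuousOn_stopLoss_integrand (hQ : ContinuousOn Q (Icc 0 1)) (q : ℝ) :
    ContinuousOn (fun t => max (Q t - q) 0) (Icc 0 1) :=
  ContinuousOn.sup (hQ.sub continuousOn_const) continuousOn_const

lemma integral_layer (hQ : ContinuousOn Q (Icc 0 1)) (q₂ q₁ : ℝ) :
    ∫ t in (0 : ℝ)..1, layer q₂ q₁ (Q t) = stopLoss Q q₂ - stopLoss Q q₁ :=
  intervalIntegral.integral_sub
    ((continuousOn_stopLoss_integrand hQ q₂).intervalIntegrable_of_Icc zero_le_one)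
    ((continuousOn_stopLoss_integrand hQ q₁).intervalIntegrable_of_Icc zero_le_one)

lemma continuous_stopLoss (hQ : ContinuousOn Q (Icc 0 1)) : Continuous (stopLoss Q) := by
  have : LipschitzWith 1 (stopLoss Q) := by
    apply LipschitzWith.of_dist_le_mul
    intro q r
    rw [Real.dist_eq, Real.dist_eq, ← integral_layer hQ]
    have := intervalIntegral.norm_integral_le_of_norm_le_const (a := (0 : ℝ)) (b := 1)
      (C := |q - r|) (f := fun t => layer q r (Q t)) fun t _ => ?_
    · simpa using this
    · rw [Real.norm_eq_abs, layer]
      refine (abs_max_sub_max_le_abs _ _ _).trans (le_of_eq ?_)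
      rw [abs_sub_comm q]
      congr 1
      ring
  exact this.continuous

/-- The integrands are continuous and ordered, so strictness at the single point `t = 1` suffices.
-/
lemma stopLoss_lt (hQ : ContinuousOn Q (Icc 0 1)) {q r : ℝ} (hqr : q < r) (hr : r ≤ Q 1) :
    stopLoss Q r < stopLoss Q q := by
  apply intervalIntegral.integral_lt_integral_of_continuousOn_of_le_of_exists_lt zero_lt_one
    (continuousOn_stopLoss_integrand hQ r) (continuousOn_stopLoss_integrand hQ q)
  · intro t _
    exact max_le_max (by linarith) le_rfl
  · refine ⟨1, ⟨zero_le_one, le_rfl⟩, ?_⟩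
    rw [max_eq_left (by linarith), max_eq_left (by linarith)]
    linarith

end StopLoss

/-- The value at `M` gives the width, and vanishing at each other's lower threshold gives the
position. A layer of width zero would carry no information, hence the strict inequalities. -/
lemma layer_thresholds_unique {q₂ q₁ r₂ r₁ M : ℝ} (hq₂ : 0 ≤ q₂) (hq : q₂ < q₁) (hq₁ : q₁ ≤ M)
    (hr₂ : 0 ≤ r₂) (hr : r₂ < r₁) (hr₁ : r₁ ≤ M)
    (h : ∀ x ∈ Icc 0 M, layer q₂ q₁ x = layer r₂ r₁ x) : q₂ = r₂ ∧ q₁ = r₁ := by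
  have hM := h M ⟨by linarith, le_rfl⟩
  rw [layer_of_ge hq.le hq₁, layer_of_ge hr.le hr₁] at hM
  have h1 := h q₂ ⟨hq₂, by linarith⟩
  have h2 := h r₂ ⟨hr₂, by linarith⟩
  rw [layer_of_le hq.le le_rfl] at h1
  rw [layer_of_le hr.le le_rfl] at h2
  unfold layer at h1 h2
  grind

/-- For a fixed upper level, the lower level is unique within a level set of `Q`. -/
lemma RetentionSetting.lower_level_unique {T Q : ℝ → ℝ} {α a z₂ y₂ z₁ : ℝ}
    (h : RetentionSetting T Q α a) (hz₂ : 0 ≤ z₂) (hzy : z₂ < y₂) (hy₂ : y₂ ≤ a)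
    (hz₁ : z₁ ∈ Ico a 1) (hgz : gap T Q α z₂ z₁ = 0) (hgy : gap T Q α y₂ z₁ = 0)
    (hQ : Q z₂ = Q y₂) (hlt : Q z₂ < Q z₁) : False := by
  have ⟨ha0, ha1⟩ := h.Ioo_turning
  -- At `y₂ = a` the gap equation forces `z₁ = a`, which contradicts distinct thresholds.
  rcases hy₂.lt_or_eq with hya | rfl
  swap
  · rw [hQ, h.eq_turning_of_gap hz₁ hgy] at hlt
    exact lt_irrefl _ hlt
  have m₂ : z₂ ∈ Icc (0 : ℝ) 1 := ⟨hz₂, by linarith⟩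
  have my : y₂ ∈ Icc (0 : ℝ) 1 := ⟨by linarith, by linarith⟩
  have ma : a ∈ Icc (0 : ℝ) 1 := ⟨ha0.le, ha1.le⟩
  have m₁ : z₁ ∈ Icc (0 : ℝ) 1 := ⟨by linarith [hz₁.1], hz₁.2.le⟩
  rw [h.gap_eq_sub m₂ m₁, hQ, ← intervalIntegral.integral_add_adjacent_intervals
    (h.intervalIntegrable_exp (Q y₂) m₂ my) (h.intervalIntegrable_exp (Q y₂) my m₁)] at hgz
  rw [h.gap_eq_sub my m₁] at hgy
  rw [← intervalIntegral.integral_add_adjacent_intervals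
    (h.intervalIntegrable_exp (Q y₂) my ma) (h.intervalIntegrable_exp (Q y₂) ma m₁)] at hgy hgz
  have hanti := h.strictAntiOn_exp_sub (Q y₂)
  -- Equal `Q`-values give both equations the same `p` and `lam`. Subtracting them shows that `p`
  -- averages to `lam` on `[z₂,y₂]`, whence `p y₂ ≤ lam`. Then `p` averages strictly below `lam` on
  -- `[y₂,a]` and at most `lam` on `[a,z₁]`, against the equation for `y₂`.
  set p : ℝ → ℝ := fun t => Real.exp (α * (Q t - Q y₂)) * deriv T t with hp
  set lam := Real.exp (α * (Q z₁ - Q y₂)) * chordSlope T z₁ with hlam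
  have hym : y₂ ∈ Ioc 0 a := ⟨by linarith, hya.le⟩
  have hbound := h.integral_exp_le (Q y₂) ha0.le hz₁.1 hz₁.2.le
  have hfm := h.turning.2.2.monotoneOn ⟨le_rfl, ha1⟩ hz₁ hz₁.1
  have h4 := InverseSShaped.chordSlope_mul T ha1
  have h5 := InverseSShaped.chordSlope_mul T hz₁.2
  have htail : ∫ t in a..z₁, p t ≤ (z₁ - a) * lam := by
    refine hbound.trans ?_
    have h6 := mul_nonneg (Real.exp_pos (α * (Q z₁ - Q y₂))).le
      (mul_nonneg (sub_nonneg.2 hfm) (sub_nonneg.2 ha1.le))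
    have h7 : T z₁ - T a = chordSlope T a * (1 - a) - chordSlope T z₁ * (1 - z₁) := by linarith
    rw [h7]
    nlinarith
  have hleft : (y₂ - z₂) * p y₂ ≤ ∫ t in z₂..y₂, p t := by
    rw [← smul_eq_mul, ← intervalIntegral.integral_const]
    apply intervalIntegral.integral_mono_on_of_le_Ioo hzy.le intervalIntegrable_const
      (h.intervalIntegrable_exp (Q y₂) m₂ my)
    intro t ht
    exact (hanti ⟨hz₂.trans_lt ht.1, (ht.2.trans hya).le⟩ hym ht.2).le
  have hright : ∫ t in y₂..a, p t < (a - y₂) * p y₂ := by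
    rw [← smul_eq_mul, ← intervalIntegral.integral_const]
    apply intervalIntegral.integral_lt_integral_of_ae_le_of_measure_setOfPred_lt_ne_zero hya.le
      (h.intervalIntegrable_exp (Q y₂) my ma) intervalIntegrable_const
    · filter_upwards [ae_restrict_mem measurableSet_Ioc] with t ht
      exact (hanti hym ⟨hym.1.trans ht.1, ht.2⟩ ht.1).le
    · have hsub : Ioc y₂ a ⊆ {t | p t < p y₂} := fun t ht =>
        hanti hym ⟨hym.1.trans ht.1, ht.2⟩ ht.1
      rw [Measure.restrict_apply' measurableSet_Ioc, inter_eq_self_of_subset_right hsub]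
      simp [hya]
  have hpl : p y₂ ≤ lam := by
    have : (y₂ - z₂) * p y₂ ≤ (y₂ - z₂) * lam := by linarith
    exact le_of_mul_le_mul_left this (sub_pos.2 hzy)
  have := mul_le_mul_of_nonneg_left hpl (sub_pos.2 hya).le
  linarith

/-! ### Existence, optimality and uniqueness of the contracts. -/

section Contracts

variable {Ω : Type*} [MeasurableSpace Ω] {P : Measure Ω} [IsProbabilityMeasure P]
  {X : Ω → ℝ} {T u : ℝ → ℝ} {M : ℝ}

lemma LossAssumption.integral_layer_contract (hX : LossAssumption P X M) (hM : 0 < M)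
    {q₂ q₁ : ℝ} (h₂ : 0 ≤ q₂) (h₁ : q₂ ≤ q₁) {J : ℝ → ℝ}
    (hJ : EqOn J (fun x => x - layer q₂ q₁ x) (Icc 0 M)) :
    ∫ ω, J (X ω) ∂P = (∫ ω, X ω ∂P) -
      (stopLoss (quantile P X) q₂ - stopLoss (quantile P X) q₁) := by
  rw [hX.integral_indemnity hM (isIndemnity_of_layer hM h₂ h₁ hJ),
    ← integral_layer hX.continuousOn_quantile]
  congr 1
  apply intervalIntegral.integral_congr
  intro t ht
  rw [uIcc_of_le zero_le_one] at ht
  simp only [retention]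
  rw [hJ (hX.quantile_mem hM ht)]
  ring

lemma LossAssumption.retainedMean_eq (hX : LossAssumption P X M) (hM : 0 < M) {l : ℝ}
    (hl : l ∈ Icc (0 : ℝ) 1) : retainedMean P X l =
      stopLoss (quantile P X) 0 - stopLoss (quantile P X) (quantile P X l) := by
  rw [retainedMean, ← integral_layer hX.continuousOn_quantile]
  apply intervalIntegral.integral_congr
  intro t ht
  rw [uIcc_of_le zero_le_one] at ht
  simp only
  split_ifs with htl
  · rw [layer_of_mem (quantile_nonneg _ _ _) (hX.monotoneOn_quantile hM ht hl htl.le), sub_zero]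
  · rw [layer_of_ge (quantile_nonneg _ _ _) (hX.monotoneOn_quantile hM hl ht (not_lt.1 htl)),
      sub_zero]

lemma LossAssumption.integral_threefold (hX : LossAssumption P X M) (hM : 0 < M)
    {z₂ z₁ : ℝ} (h₂ : 0 ≤ z₂) (h : z₂ ≤ z₁) (h₁ : z₁ ≤ 1) :
    ∫ ω, threefold (quantile P X z₂) (quantile P X z₁) (X ω) ∂P = (∫ ω, X ω ∂P) -
      (stopLoss (quantile P X) (quantile P X z₂) - stopLoss (quantile P X) (quantile P X z₁)) :=
  have hq := hX.monotoneOn_quantile hM ⟨h₂, h.trans h₁⟩ ⟨h₂.trans h, h₁⟩ h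
  hX.integral_layer_contract hM (quantile_nonneg _ _ _) hq fun x _ => threefold_eq hq x

lemma LossAssumption.integral_deductible (hX : LossAssumption P X M) (hM : 0 < M) (s : ℝ) :
    ∫ ω, deductible (quantile P X s) (X ω) ∂P = (∫ ω, X ω ∂P) -
      (stopLoss (quantile P X) 0 - stopLoss (quantile P X) (quantile P X s)) :=
  hX.integral_layer_contract hM le_rfl (quantile_nonneg _ _ _) fun _ hx =>
    deductible_eq (quantile_nonneg _ _ _) hx.1

lemma LossAssumption.stopLoss_zero (hX : LossAssumption P X M) (hM : 0 < M) :
    stopLoss (quantile P X) 0 = ∫ ω, X ω ∂P := by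
  rw [stopLoss, hX.integral_comp_eq hM (φ := fun x => x) continuousOn_id]
  apply intervalIntegral.integral_congr
  intro t _
  simp [quantile_nonneg]

lemma LossAssumption.stopLoss_top (hX : LossAssumption P X M) (hM : 0 < M) :
    stopLoss (quantile P X) M = 0 := by
  rw [stopLoss, intervalIntegral.integral_congr (g := fun _ => 0), intervalIntegral.integral_zero]
  intro t ht
  rw [uIcc_of_le zero_le_one] at ht
  simp only
  rw [max_eq_right]
  linarith [(hX.quantile_mem hM ht).2]

lemma LossAssumption.retentionSetting (hX : LossAssumption P X M) (hM : 0 < M)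
    (hT : InverseSShaped T) {α a b W : ℝ} (hα : 0 < α) (hcara : ∀ x, 0 < x → arrowPratt u x = α)
    (ha : IsTurningPoint T a) (hda : deriv T a = chordSlope T a) (hab : a < b) (hb : b < 1)
    (hanti : StrictAntiOn (deriv T) (Ioc 0 b)) (hW : M ≤ W)
    (hdom : RiskAversionAssumption P X T u W a) :
    RetentionSetting T (quantile P X) α a where
  weighting := hT
  turning := ha
  deriv_turning := hda
  strictAntiOn_deriv := hanti.mono (Ioc_subset_Ioc_right hab.le)
  pos := hα
  absCont := hX.absCont_quantile
  monotoneOn := hX.monotoneOn_quantile hM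
  strictAntiOn_exp := by
    apply hT.strictAntiOn_exp_mul_deriv hX.absCont_quantile hab hb hanti
    intro z hz hd
    have hz1 : z ∈ Icc (0 : ℝ) 1 := ⟨hz.1.le, hz.2.trans ha.1.2.le⟩
    have h := hdom.dominance z hz hd
    rcases (hX.quantile_mem hM hz1).2.lt_or_eq with hlt | heq
    · rwa [hcara _ (by linarith)] at h
    · have hmax : IsLocalMax (quantile P X) z := by
        filter_upwards [Ioo_mem_nhds hz.1 (hz.2.trans_lt ha.1.2)] with t ht
        rw [heq]
        exact (hX.quantile_mem hM (Ioo_subset_Icc_self ht)).2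
      rw [hmax.deriv_eq_zero, mul_zero] at h ⊢
      exact h

/-- The integral that couples the thresholds is a positive multiple of the gap. -/
lemma LossAssumption.integral_eq_gap (hX : LossAssumption P X M) (hM : 0 < M) {α A w : ℝ}
    (hu : ∀ x, 0 < x → deriv u x = A * α * Real.exp (-α * x)) (hw : M < w) {z₂ z₁ : ℝ}
    (h₂ : 0 ≤ z₂) (h : z₂ ≤ z₁) (h₁ : z₁ ≤ 1) :
    (∫ t in z₂..z₁, (deriv u (w - quantile P X z₁ + quantile P X z₂) * (1 - T z₁) / (1 - z₁)
      - deriv u (w - quantile P X t + quantile P X z₂) * deriv T t)) =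
      A * α * Real.exp (-α * w) * gap T (quantile P X) α z₂ z₁ := by
  rw [gap, ← intervalIntegral.integral_const_mul]
  have hval : ∀ t ∈ Icc (0 : ℝ) 1, deriv u (w - quantile P X t + quantile P X z₂) =
      A * α * Real.exp (-α * w) * Real.exp (α * (quantile P X t - quantile P X z₂)) := by
    intro t ht
    have h1 := (hX.quantile_mem hM ht).2
    have h2 := quantile_nonneg P X z₂
    rw [hu _ (by linarith), mul_assoc _ (Real.exp _), ← Real.exp_add]
    ring_nf
  apply intervalIntegral.integral_congr
  intro t ht
  rw [uIcc_of_le h] at ht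
  simp only
  rw [hval t ⟨h₂.trans ht.1, ht.2.trans h₁⟩, hval z₁ ⟨h₂.trans h, h₁⟩, chordSlope]
  ring

lemma LossAssumption.hFun_eq_zero_iff (hX : LossAssumption P X M) (hM : 0 < M) {α A w : ℝ}
    (hα : 0 < α) (hA : 0 < A) (hu : ∀ x, 0 < x → deriv u x = A * α * Real.exp (-α * x))
    (hw : M < w) {z : ℝ} (hz : z ∈ Icc (0 : ℝ) 1) :
    hFun P X T u w z = 0 ↔ gap T (quantile P X) α 0 z = 0 := by
  have h := hX.integral_eq_gap (T := T) hM hu hw le_rfl hz.1 hz.2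
  rw [hX.quantile_zero hM] at h
  simp only [add_zero] at h
  have hpos : A * α * Real.exp (-α * w) ≠ 0 := by positivity
  rw [hFun, h, mul_eq_zero, or_iff_right hpos]

/-- A threefold pair is stationary and has distinct thresholds, if the budget does not suffice
for full insurance. -/
lemma LossAssumption.isStationary_of_isThreefoldPair (hX : LossAssumption P X M) (hM : 0 < M)
    {α A ρ W₀ π a z₂ z₁ : ℝ} (hα : 0 < α) (hA : 0 < A)
    (hu : ∀ x, 0 < x → deriv u x = A * α * Real.exp (-α * x)) (hw : M < W₀ - π)
    (h : RetentionSetting T (quantile P X) α a) (hπ : π / (1 + ρ) < ∫ ω, X ω ∂P)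
    (hp : IsThreefoldPair P X T u ρ W₀ a π z₂ z₁) :
    RetentionSetting.IsStationary T (quantile P X) α a z₂ z₁ ∧
      gap T (quantile P X) α z₂ z₁ = 0 ∧ quantile P X z₂ < quantile P X z₁ := by
  obtain ⟨h₂, h₂a, h₁a, h₁, hgap, hb⟩ := hp
  have h21 := h₂a.trans h₁a
  rw [hX.integral_eq_gap hM hu hw h₂ h21 h₁.le, mul_eq_zero,
    or_iff_right (by positivity)] at hgap
  rw [hX.integral_threefold hM h₂ h21 h₁.le] at hb
  -- Equal thresholds would mean full insurance, which the budget excludes.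
  have hne : quantile P X z₂ ≠ quantile P X z₁ := by
    intro heq
    rw [heq] at hb
    linarith
  have hz₂a : z₂ < a := by
    refine lt_of_le_of_ne h₂a fun heq => hne ?_
    subst heq
    rw [h.eq_turning_of_gap ⟨h₁a, h₁⟩ hgap]
  exact ⟨⟨h₂, hz₂a, h₁a, h₁, hgap.ge, fun _ => hgap⟩, hgap,
    lt_of_le_of_ne (hX.monotoneOn_quantile hM ⟨h₂, h21.trans h₁.le⟩ ⟨h₂.trans h21, h₁.le⟩ h21) hne⟩

lemma LossAssumption.isOptimal_iff_threefold (hX : LossAssumption P X M) (hM : 0 < M)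
    (hT : InverseSShaped T) {α A B ρ W₀ π a z₂ z₁ : ℝ} (hA : 0 < A) (hρ : -1 < ρ)
    (hu : ∀ x, 0 ≤ x → u x = B - A * Real.exp (-α * x))
    (hu' : ∀ x, 0 < x → deriv u x = A * α * Real.exp (-α * x)) (hw : M < W₀ - π)
    (h : RetentionSetting T (quantile P X) α a) (hπ : π / (1 + ρ) < ∫ ω, X ω ∂P)
    (hp : IsThreefoldPair P X T u ρ W₀ a π z₂ z₁) (I : ℝ → ℝ) :
    IsOptimal hT u P X M ρ W₀ π I ↔
      EqOn I (threefold (quantile P X z₂) (quantile P X z₁)) (Icc 0 M) := by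
  obtain ⟨hs, -, hlt⟩ := hX.isStationary_of_isThreefoldPair hM h.pos hA hu' hw h hπ hp
  exact hX.isOptimal_iff_of_isStationary hM hT hA hρ hu hw.le h hs
    (fun x _ => threefold_eq hlt.le x) hp.2.2.2.2.2 I

/-- Uniqueness of the thresholds, and of the levels if a threshold is not an atom. -/
lemma LossAssumption.isThreefoldPair_unique (hX : LossAssumption P X M) (hM : 0 < M)
    (hT : InverseSShaped T) {α A B ρ W₀ π a z₂ z₁ y₂ y₁ : ℝ} (hA : 0 < A) (hρ : -1 < ρ)
    (hu : ∀ x, 0 ≤ x → u x = B - A * Real.exp (-α * x))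
    (hu' : ∀ x, 0 < x → deriv u x = A * α * Real.exp (-α * x)) (hw : M < W₀ - π)
    (h : RetentionSetting T (quantile P X) α a) (hπ : π / (1 + ρ) < ∫ ω, X ω ∂P)
    (hz : IsThreefoldPair P X T u ρ W₀ a π z₂ z₁)
    (hy : IsThreefoldPair P X T u ρ W₀ a π y₂ y₁) :
    quantile P X y₂ = quantile P X z₂ ∧ quantile P X y₁ = quantile P X z₁ ∧
      (P (X ⁻¹' {quantile P X z₂}) = 0 ∨ P (X ⁻¹' {quantile P X z₁}) = 0 →
        y₂ = z₂ ∧ y₁ = z₁) := by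
  obtain ⟨sz, gz, ltz⟩ := hX.isStationary_of_isThreefoldPair hM h.pos hA hu' hw h hπ hz
  obtain ⟨sy, gy, lty⟩ := hX.isStationary_of_isThreefoldPair hM h.pos hA hu' hw h hπ hy
  have ha1 := h.Ioo_turning.2
  have ha0 := h.Ioo_turning.1
  have mz₂ : z₂ ∈ Icc (0 : ℝ) 1 := ⟨sz.nonneg, (sz.lt_turning.trans ha1).le⟩
  have my₂ : y₂ ∈ Icc (0 : ℝ) 1 := ⟨sy.nonneg, (sy.lt_turning.trans ha1).le⟩
  have mz₁ : z₁ ∈ Icc (0 : ℝ) 1 := ⟨ha0.le.trans sz.turning_le, sz.lt_one.le⟩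
  have my₁ : y₁ ∈ Icc (0 : ℝ) 1 := ⟨ha0.le.trans sy.turning_le, sy.lt_one.le⟩
  -- Both pairs describe the unique optimal contract.
  have heq := (hX.isOptimal_iff_threefold hM hT hA hρ hu hu' hw h hπ hy _).1
    ((hX.isOptimal_iff_threefold hM hT hA hρ hu hu' hw h hπ hz _).2 fun _ _ => rfl)
  obtain ⟨e₂, e₁⟩ := layer_thresholds_unique (quantile_nonneg P X y₂) lty
    (hX.quantile_mem hM my₁).2 (quantile_nonneg P X z₂) ltz (hX.quantile_mem hM mz₁).2
    fun x hx => by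
      have := heq hx
      rw [threefold_eq ltz.le, threefold_eq lty.le] at this
      linarith
  refine ⟨e₂, e₁, ?_⟩
  rintro (h0 | h0)
  · have e := hX.eq_of_quantile_eq hM my₂ mz₂ e₂ h0
    subst e
    exact ⟨rfl, (h.strictMonoOn_gap ⟨sy.nonneg, sy.lt_turning.le⟩).injOn
      ⟨sy.turning_le, sy.lt_one⟩ ⟨sz.turning_le, sz.lt_one⟩ (gy.trans gz.symm)⟩
  · have e := hX.eq_of_quantile_eq hM my₁ mz₁ e₁ h0
    subst e
    refine ⟨?_, rfl⟩
    rcases lt_trichotomy y₂ z₂ with hlt | heq | hgt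
    · exact (h.lower_level_unique sy.nonneg hlt sz.lt_turning.le ⟨sy.turning_le, sy.lt_one⟩
        gy gz e₂ lty).elim
    · exact heq
    · exact (h.lower_level_unique sz.nonneg hgt sy.lt_turning.le ⟨sy.turning_le, sy.lt_one⟩
        gz gy e₂.symm ltz).elim

/-- Along the curve of zeros of the gap the retained mean moves continuously from `retainedMean P X
l` at `z₂ = 0` to `0` at `z₂ = a`, and the required value lies in between. -/
lemma LossAssumption.exists_isThreefoldPair (hX : LossAssumption P X M) (hM : 0 < M)
    {α A ρ W₀ π a l : ℝ} (hρ : -1 < ρ)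
    (hu' : ∀ x, 0 < x → deriv u x = A * α * Real.exp (-α * x)) (hw : M < W₀ - π)
    (h : RetentionSetting T (quantile P X) α a) (hl : l ∈ Ico a 1)
    (hgap : gap T (quantile P X) α 0 l = 0)
    (hπl : (1 + ρ) * ((∫ ω, X ω ∂P) - retainedMean P X l) < π)
    (hπ : π / (1 + ρ) < ∫ ω, X ω ∂P) :
    ∃ z₂ z₁, IsThreefoldPair P X T u ρ W₀ a π z₂ z₁ := by
  have ha1 := h.Ioo_turning.2
  have ha0 := h.Ioo_turning.1
  have hρ' : 0 < 1 + ρ := by linarith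
  obtain ⟨ζ, hζ, hcont⟩ := h.exists_continuousOn_zero
  have m0 : (0 : ℝ) ∈ Icc 0 a := ⟨le_rfl, ha0.le⟩
  have ma : a ∈ Icc 0 a := ⟨ha0.le, le_rfl⟩
  have hζ0 : ζ 0 = l := (h.strictMonoOn_gap m0).injOn (hζ 0 m0).1 hl ((hζ 0 m0).2.trans hgap.symm)
  have hζa : ζ a = a := h.eq_turning_of_gap (hζ a ma).1 (hζ a ma).2
  have hS := continuous_stopLoss hX.continuousOn_quantile
  have hQ := hX.continuousOn_quantile
  have hbc : ContinuousOn (fun z => stopLoss (quantile P X) (quantile P X z) -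
      stopLoss (quantile P X) (quantile P X (ζ z))) (Icc 0 a) := by
    apply ContinuousOn.sub
    · exact hS.comp_continuousOn (hQ.mono (Icc_subset_Icc_right ha1.le))
    · exact hS.comp_continuousOn (hQ.comp hcont fun z hz =>
        ⟨ha0.le.trans (hζ z hz).1.1, (hζ z hz).1.2.le⟩)
  have hret := hX.retainedMean_eq hM (l := l) ⟨ha0.le.trans hl.1, hl.2.le⟩
  rw [← lt_div_iff₀' hρ'] at hπl
  obtain ⟨z, hz, hbz⟩ := intermediate_value_Icc' ha0.le hbc
    (show (∫ ω, X ω ∂P) - π / (1 + ρ) ∈ _ from ⟨by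
      simp only [hζa, sub_self]
      linarith, by
      simp only [hζ0, hX.quantile_zero hM]
      linarith⟩)
  have hz1 := (hζ z hz).1
  have hle := hz.2.trans hz1.1
  refine ⟨z, ζ z, hz.1, hz.2, hz1.1, hz1.2, ?_, ?_⟩
  · rw [hX.integral_eq_gap hM hu' hw hz.1 hle hz1.2.le, (hζ z hz).2, mul_zero]
  · rw [hX.integral_threefold hM hz.1 hle hz1.2.le]
    simp only at hbz
    linarith

lemma LossAssumption.isDeductibleLevel_unique (hX : LossAssumption P X M) (hM : 0 < M)
    {ρ π r s : ℝ} (hr : IsDeductibleLevel P X ρ π r) (hs : IsDeductibleLevel P X ρ π s) :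
    quantile P X r = quantile P X s ∧ (P (X ⁻¹' {quantile P X s}) = 0 → r = s) := by
  have h1 := hr.2.trans hs.2.symm
  rw [hX.integral_deductible hM, hX.integral_deductible hM] at h1
  have heq : quantile P X r = quantile P X s := by
    rcases lt_trichotomy (quantile P X r) (quantile P X s) with h | h | h
    · have := stopLoss_lt hX.continuousOn_quantile h
        (by rw [hX.quantile_one hM]; exact (hX.quantile_mem hM hs.1).2)
      linarith
    · exact h
    · have := stopLoss_lt hX.continuousOn_quantile h
        (by rw [hX.quantile_one hM]; exact (hX.quantile_mem hM hr.1).2)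
      linarith
  exact ⟨heq, hX.eq_of_quantile_eq hM hr.1 hs.1 heq⟩

/-- Existence and optimality of the deductible contract for small premiums. -/
lemma LossAssumption.exists_isDeductibleLevel (hX : LossAssumption P X M) (hM : 0 < M)
    (hT : InverseSShaped T) {α A B ρ W₀ π a l : ℝ} (hA : 0 < A) (hρ : -1 < ρ)
    (hu : ∀ x, 0 ≤ x → u x = B - A * Real.exp (-α * x)) (hw : M ≤ W₀ - π)
    (h : RetentionSetting T (quantile P X) α a) (hl : l ∈ Ico a 1)
    (hgap : gap T (quantile P X) α 0 l = 0) (hπ0 : 0 ≤ π)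
    (hπl : π ≤ (1 + ρ) * ((∫ ω, X ω ∂P) - retainedMean P X l)) :
    ∃ s, IsDeductibleLevel P X ρ π s ∧ ∀ I, IsOptimal hT u P X M ρ W₀ π I ↔
      EqOn I (deductible (quantile P X s)) (Icc 0 M) := by
  have ha1 := h.Ioo_turning.2
  have ha0 := h.Ioo_turning.1
  have hl0 : 0 ≤ l := ha0.le.trans hl.1
  have hρ' : 0 < 1 + ρ := by linarith
  have hS := continuous_stopLoss hX.continuousOn_quantile
  have hbc : ContinuousOn (fun s => stopLoss (quantile P X) 0 -
      stopLoss (quantile P X) (quantile P X s)) (Icc l 1) :=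
    continuousOn_const.sub
      (hS.comp_continuousOn (hX.continuousOn_quantile.mono (Icc_subset_Icc_left hl0)))
  have hret := hX.retainedMean_eq hM (l := l) ⟨hl0, hl.2.le⟩
  rw [← div_le_iff₀' hρ'] at hπl
  have hπ0' := div_nonneg hπ0 hρ'.le
  -- Searching only in `[l,1]` makes the gap at `s` nonnegative, which is all that stationarity asks
  -- at the corner `z₂ = 0`.
  obtain ⟨s, hs, hbs⟩ := intermediate_value_Icc hl.2.le hbc
    (show (∫ ω, X ω ∂P) - π / (1 + ρ) ∈ _ from ⟨by linarith, by
      simp only [hX.quantile_one hM, hX.stopLoss_top hM, hX.stopLoss_zero hM]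
      linarith⟩)
  have hbudget : ∫ ω, deductible (quantile P X s) (X ω) ∂P = π / (1 + ρ) := by
    rw [hX.integral_deductible hM]
    simp only at hbs
    linarith
  refine ⟨s, ⟨⟨hl0.trans hs.1, hs.2⟩, hbudget⟩, fun I => ?_⟩
  have hded : ∀ x ∈ Icc 0 M, deductible (quantile P X s) x = x - layer 0 (quantile P X s) x :=
    fun x hx => deductible_eq (quantile_nonneg _ _ _) hx.1
  -- The chord slope is meaningless at `s = 1`; there the deductible is `M` and the contract pays
  -- nothing.
  rcases hs.2.lt_or_eq with hlt | rfl
  · have hst : RetentionSetting.IsStationary T (quantile P X) α a 0 s := by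
      refine ⟨le_rfl, ha0, hl.1.trans hs.1, hlt, ?_, fun h0 => absurd h0 (lt_irrefl 0)⟩
      refine hgap.symm.le.trans ?_
      exact (h.strictMonoOn_gap ⟨le_rfl, ha0.le⟩).monotoneOn hl ⟨hl.1.trans hs.1, hlt⟩ hs.1
    refine hX.isOptimal_iff_of_isStationary hM hT hA hρ hu hw h hst ?_ hbudget I
    rw [hX.quantile_zero hM]
    exact hded
  · refine hX.isOptimal_iff_none hM hT h.pos hA hρ hu hw ?_ hbudget I
    intro x hx
    rw [hded x hx, hX.quantile_one hM, layer_of_mem hx.1 hx.2]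
    ring

end Contracts

end RDUInsurance

theorem mainTheorem5 {Ω : Type*} [MeasurableSpace Ω] (P : Measure Ω) [IsProbabilityMeasure P]
    (X : Ω → ℝ) (T u : ℝ → ℝ) (M ρ W₀ : ℝ) (hM : 0 < M) (hρ : -1 < ρ)
    (hX : LossAssumption P X M) (hT : InverseSShaped T)
    (hu : StrictlyConcaveUtility u) (hcara : IsCARA u)
    (hW : 0 ≤ W₀ - (1 + ρ) * (∫ ω, X ω ∂P) - M) :
    ∃ a c : ℝ, (∀ x, IsTurningPoint T x ↔ x = a) ∧ (∀ x, IsCrossingPoint T a x ↔ x = c) ∧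
    (RiskAversionAssumption P X T u (W₀ - (1 + ρ) * ∫ ω, X ω ∂P) a →
      ∃ l : ℝ,
        (∀ π ∈ Ico 0 ((1 + ρ) * ∫ ω, X ω ∂P), ∀ z,
          (z ∈ Icc a c ∧ hFun P X T u (W₀ - π) z = 0) ↔ z = l) ∧
        -- full coverage
        (∀ π, π = (1 + ρ) * ∫ ω, X ω ∂P →
          ∀ I, IsOptimal hT u P X M ρ W₀ π I ↔ EqOn I (fun z => z) (Icc 0 M)) ∧
        -- threefold contract
        (∀ π, (1 + ρ) * ((∫ ω, X ω ∂P) - retainedMean P X l) < π →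
          π < (1 + ρ) * ∫ ω, X ω ∂P →
          ∃ z₂ z₁, IsThreefoldPair P X T u ρ W₀ a π z₂ z₁ ∧
            (∀ y₂ y₁, IsThreefoldPair P X T u ρ W₀ a π y₂ y₁ →
              quantile P X y₂ = quantile P X z₂ ∧ quantile P X y₁ = quantile P X z₁ ∧
              (P (X ⁻¹' {quantile P X z₂}) = 0 ∨ P (X ⁻¹' {quantile P X z₁}) = 0 →
                y₂ = z₂ ∧ y₁ = z₁)) ∧
            ∀ I, IsOptimal hT u P X M ρ W₀ π I ↔
              EqOn I (threefold (quantile P X z₂) (quantile P X z₁)) (Icc 0 M)) ∧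
        -- deductible contract
        (∀ π, 0 ≤ π → π ≤ (1 + ρ) * ((∫ ω, X ω ∂P) - retainedMean P X l) →
          ∃ s, IsDeductibleLevel P X ρ π s ∧
            (∀ r, IsDeductibleLevel P X ρ π r → quantile P X r = quantile P X s ∧
              (P (X ⁻¹' {quantile P X s}) = 0 → r = s)) ∧
            ∀ I, IsOptimal hT u P X M ρ W₀ π I ↔
              EqOn I (deductible (quantile P X s)) (Icc 0 M))) := by
  set EX := ∫ ω, X ω ∂P with hEX
  have hρ' : 0 < 1 + ρ := by linarith
  obtain ⟨a, ha, hda, b, hab, hb, hanti⟩ := hT.exists_turningPoint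
  have hta := (ha a).2 rfl
  obtain ⟨c, hc⟩ := hT.exists_crossingPoint hta
  have hcc := (hc c).2 rfl
  obtain ⟨α, A, B, hα, hA, hu₀, hu₁, harrow⟩ := hu.exists_eq_exp hcara
  refine ⟨a, c, ha, hc, fun hdom => ?_⟩
  have h := hX.retentionSetting hM hT hα harrow hta hda hab hb hanti (by linarith) hdom
  obtain ⟨l, hl, hluniq⟩ := h.exists_unique_level hcc
  have hl' : l ∈ Ico a 1 := ⟨hl.1, hl.2.trans_lt hcc.1.2⟩
  have hgap := ((hluniq l).2 rfl).2
  refine ⟨l, ?_, ?_, ?_, ?_⟩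
  · intro π hπ z
    rw [← hluniq z]
    refine and_congr_right fun hz => hX.hFun_eq_zero_iff hM hα hA hu₁ ?_
      ⟨hta.1.1.le.trans hz.1, hz.2.trans hcc.1.2.le⟩
    linarith [hπ.2]
  · intro π hπ I
    exact hX.isOptimal_iff_full hM hT hα hA hρ hu₀ (by linarith) hπ I
  · intro π hπl hπ
    have hw : M < W₀ - π := by linarith
    have hπ' : π / (1 + ρ) < EX := by rwa [div_lt_iff₀' hρ']
    obtain ⟨z₂, z₁, hz⟩ := hX.exists_isThreefoldPair hM hρ hu₁ hw h hl' hgap hπl hπ'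
    exact ⟨z₂, z₁, hz,
      fun y₂ y₁ hy => hX.isThreefoldPair_unique hM hT hA hρ hu₀ hu₁ hw h hπ' hz hy,
      hX.isOptimal_iff_threefold hM hT hA hρ hu₀ hu₁ hw h hπ' hz⟩
  · intro π hπ0 hπl
    -- Ensures `π ≤ (1 + ρ) E[X]`, so that solvency gives final wealth in the domain of `u`.
    have hret : 0 ≤ retainedMean P X l := by
      apply intervalIntegral.integral_nonneg zero_le_one
      intro z _
      split_ifs <;> exact quantile_nonneg _ _ _
    have hw : M ≤ W₀ - π := by linarith [mul_nonneg hρ'.le hret]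
    obtain ⟨s, hs, hopt⟩ := hX.exists_isDeductibleLevel hM hT hA hρ hu₀ hw h hl' hgap hπ0 hπl
    exact ⟨s, hs, fun r hr => hX.isDeductibleLevel_unique hM hr hs, hopt⟩
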